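/- Throughout, $\log$ is the binary logarithm and "universal constant" means a positive real number that depends on no parameter. **Oracle.** Let $p$ be a probability distribution on a finite set $\Omega$ and $X:\Omega\to[0,\infty)$ a random variable with mean $\mu=\mathbb E[X]$. A quantum oracle $\mathcal O$ encoding it is a unitary with $\mathcal O|0\rangle=\sum_{\omega\in\Omega}\sqrt{p(\omega)}\,|\omega\rangle|\psi_\omega\rangle$, where the $|\psi_\omega\rangle$ are arbitrary normalized states of a finite-dimensional system. Relabelling each $\omega$ by another value $Y(\omega)$ turns the same unitary into an oracle $\mathcal O_Y$ for the random variable $Y$. An algorithm may apply $\mathcal O$, $\mathcal O^\dagger$ and unitaries that do not depend on $p$ or $\mathcal O$, measure, and continue adaptively; its query complexity is the worst-case number of uses of $\mathcal O$ and $\mathcal O^\dagger$. **Quantum Monte Carlo estimator.** A Quantum Monte Carlo mean estimator is an algorithm $\mathsf{QME}(t,\delta,\mathcal O_Y)$ such that, for some universal constants $C_0,K_0$, for every random variable $Y$ with values in $[0,1]$, every $t>0$ and every $\delta\in(0,1/2]$, it makes at most $K_0t$ queries and with probability at least $1-\delta$ outputs $\hat Y$ with $|\hat Y-\mathbb E[Y]|\le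 C_0\big(\sqrt{\mathbb E[Y]}\,\log(1/\delta)/t+\log^2(1/\delta)/t^2\big)$. **Algorithm $\mathsf{QBME}(\mathcal O,n,c,B,\delta)$.** Let $k=\lfloor\log(1/\delta)\rfloor$, $t=c\,n\sqrt{\log(1/\delta)}$, $a_{-1}=0$ and $a_\ell=2^\ell B/n$. For each $0\le\ell\le k$ let $\hat\mu_\ell$ be the output of $\mathsf{QME}(t,\delta,\mathcal O_{Y_\ell})$ with $Y_\ell=\frac{X}{a_\ell}\mathbf 1_{a_{\ell-1}\le X<a_\ell}$. Output $\hat\mu=\sum_{\ell=0}^k a_\ell\hat\mu_\ell$. **Theorem.** There are a Quantum Monte Carlo mean estimator $\mathsf{QME}$ and universal constants $c,K,C$ such that, for all real $n\ge1$, $B>0$, $\delta\in(0,1/2]$, all $X\ge0$ and all oracles $\mathcal O$ as above, the algorithm $\mathsf{QBME}(\mathcal O,n,c,B,\delta)$ built on this $\mathsf{QME}$ makes at most $K\,n\,\log^{3/2}(1/\delta)=\tilde O(n)$ queries. Moreover, if $\mathbb E[|X|^{1+v}]\le u$ with $v\in(0,1]$ and $u>0$, and the segments cover $[0,B)$, that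 is, $a_k\ge B$ (equivalently $2^k\ge n$), then with probability at least $1-\delta$ $$|\hat\mu-\mu|\le\frac{\sqrt2\,\sqrt{uB^{1-v}}\,\log(1/\delta)}{c\,n}+\frac{3B\log^2(1/\delta)}{c\,n^2\sqrt{\log(1/\delta)}}+\frac{u}{B^v}.$$ In particular, if in addition $B=\Big(\frac{\sqrt u\,n}{\log(1/\delta)}\Big)^{2/(1+v)}$, then with probability at least $1-\delta$ $$|\hat\mu-\mu|\le C\,\frac{u^{\frac1{1+v}}\,(\log\frac1\delta)^{\frac{2v}{1+v}}}{n^{\frac{2v}{1+v}}}.$$ -/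

import Mathlib

open scoped BigOperators

/-! ### Quantum query algorithms

`S` is a finite set labelling the computational basis of the register on which the oracle acts. -/

/-- A gate of a circuit on the oracle register `S` together with a `d`-dimensional workspace: a fixed
unitary that does not depend on the oracle, one use of the oracle, or one use of its inverse. -/
inductive Gate (S : Type) [Fintype S] [DecidableEq S] (d : ℕ) : Type
  | unitary (V : Matrix.unitaryGroup (S × Fin d) ℂ) : Gate S d
  | oracle : Gate S d
  | oracleInv : Gate S d

namespace Gate

variable {S : Type} [Fintype S] [DecidableEq S] {d : ℕ}

/-- The action of a gate on a state vector; the oracle `U` acts as `U ⊗ 1`, its inverse as `U† ⊗ 1`. -/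
noncomputable def apply (U : Matrix.unitaryGroup S ℂ) :
    Gate S d → (S × Fin d → ℂ) → (S × Fin d → ℂ)
  | unitary V, φ => Matrix.mulVec (V : Matrix (S × Fin d) (S × Fin d) ℂ) φ
  | oracle, φ => fun x => ∑ s, (U : Matrix S S ℂ) x.1 s * φ (s, x.2)
  | oracleInv, φ => fun x => ∑ s, star ((U : Matrix S S ℂ) s x.1) * φ (s, x.2)

/-- The number of oracle queries made by a gate. -/
def cost : Gate S d → ℕ
  | unitary _ => 0
  | oracle => 1
  | oracleInv => 1

end Gate

/-- A quantum circuit: it starts in a basis state and applies a finite list of gates in order. -/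
structure Circuit (S : Type) [Fintype S] [DecidableEq S] where
  dim : ℕ
  init : S × Fin dim
  gates : List (Gate S dim)

namespace Circuit

variable {S : Type} [Fintype S] [DecidableEq S]

/-- The state at the end of the circuit, when the oracle is `U`. -/
noncomputable def finalState (C : Circuit S) (U : Matrix.unitaryGroup S ℂ) : S × Fin C.dim → ℂ :=
  C.gates.foldl (fun φ g => g.apply U φ) (Pi.single C.init 1)

/-- Born rule: the probability that measuring the final state in the computational basis gives `o`. -/
noncomputable def outcomeProb (C : Circuit S) (U : Matrix.unitaryGroup S ℂ)
    (o : S × Fin C.dim) : ℝ :=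
  ‖C.finalState U o‖ ^ 2

/-- The number of oracle queries made by the circuit. -/
def queries (C : Circuit S) : ℕ :=
  (C.gates.map Gate.cost).sum

end Circuit

/-- A quantum query algorithm with real output: it either stops with an output, or runs a circuit,
measures it, and continues in a way that may depend on the outcome. -/
inductive QueryAlg (S : Type) [Fintype S] [DecidableEq S] : Type
  | output (x : ℝ) : QueryAlg S
  | run (C : Circuit S) (next : S × Fin C.dim → QueryAlg S) : QueryAlg S

namespace QueryAlg

variable {S : Type} [Fintype S] [DecidableEq S]

/-- The probability that the output lies in `E`, when the oracle is `U`. -/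
noncomputable def prob (U : Matrix.unitaryGroup S ℂ) (E : Set ℝ) : QueryAlg S → ℝ
  | output x => E.indicator 1 x
  | run C next => ∑ o, C.outcomeProb U o * prob U E (next o)

/-- The worst-case number of uses of the oracle and its inverse. -/
def queries : QueryAlg S → ℕ
  | output _ => 0
  | run C next => C.queries + Finset.univ.sup fun o => queries (next o)

/-- Run the first algorithm and continue with one that is chosen from its output. -/
def bind : QueryAlg S → (ℝ → QueryAlg S) → QueryAlg S
  | output x, f => f x
  | run C next, f => run C fun o => bind (next o) f

/-- Run `A 0`, …, `A (m - 1)` one after the other, each with fresh registers, and output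
`∑ ℓ < m, a ℓ * (output of A ℓ)`. -/
noncomputable def weightedSum (a : ℕ → ℝ) (A : ℕ → QueryAlg S) : ℕ → QueryAlg S
  | 0 => output 0
  | m + 1 => (weightedSum a A m).bind fun s => (A m).bind fun x => output (s + a m * x)

end QueryAlg

/-! ### Oracles that encode a random variable -/

/-- `U` maps the basis state `|z⟩` to `∑ ω, √(p ω) |ω⟩|ψ_ω⟩` for some unit vectors `ψ_ω`.  The label
`ω` of the first register determines the value `X ω` of the random variable that is encoded, so that
`U` encodes every function of `ω` at the same time. -/
def IsOracle {Ω G : Type} [Fintype Ω] [DecidableEq Ω] [Fintype G] [DecidableEq G]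
    (U : Matrix.unitaryGroup (Ω × G) ℂ) (z : Ω × G) (p : Ω → ℝ) : Prop :=
  ∃ ψ : Ω → G → ℂ, (∀ ω, ∑ g, ‖ψ ω g‖ ^ 2 = 1) ∧
    ∀ ω g, (U : Matrix (Ω × G) (Ω × G) ℂ) (ω, g) z = (Real.sqrt (p ω) : ℂ) * ψ ω g

/-- The expectation of `X` under the probability weights `p`. -/
def expect {Ω : Type} [Fintype Ω] (p X : Ω → ℝ) : ℝ :=
  ∑ ω, p ω * X ω

/-- The binary logarithm of `1 / δ`. -/
noncomputable def lgInv (δ : ℝ) : ℝ :=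
  Real.logb 2 (1 / δ)

/-! ### The Quantum Monte Carlo mean estimator -/

/-- A mean estimator takes the initial basis state `z` of the oracle, the values `Y` of the random
variable, a time parameter `t` and a failure probability `δ`.  It does not get the probabilities or
the oracle itself, which it can only query. -/
def MeanEstimator : Type 1 :=
  ∀ (Ω G : Type) [Fintype Ω] [DecidableEq Ω] [Fintype G] [DecidableEq G],
    Ω × G → (Ω → ℝ) → ℝ → ℝ → QueryAlg (Ω × G)

/-- The guarantee of the Quantum Monte Carlo mean estimator for random variables in `[0, 1]`:
`O(t)` queries, and error `C (√(E Y) log(1/δ) / t + log²(1/δ) / t²)` with probability `≥ 1 - δ`. -/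
def IsQuantumMonteCarlo (QME : MeanEstimator) : Prop :=
  ∃ C > (0 : ℝ), ∃ K > (0 : ℝ),
    ∀ (Ω G : Type) [Fintype Ω] [DecidableEq Ω] [Fintype G] [DecidableEq G]
      (z : Ω × G) (Y : Ω → ℝ) (t δ : ℝ),
      (∀ ω, 0 ≤ Y ω ∧ Y ω ≤ 1) → 0 < t → 0 < δ → δ ≤ 1 / 2 →
      ((QME Ω G z Y t δ).queries : ℝ) ≤ K * t ∧
      ∀ (p : Ω → ℝ) (U : Matrix.unitaryGroup (Ω × G) ℂ),
        p ∈ stdSimplex ℝ Ω → IsOracle U z p →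
        1 - δ ≤ (QME Ω G z Y t δ).prob U
          {y | |y - expect p Y| ≤
            C * (Real.sqrt (expect p Y) * lgInv δ / t + lgInv δ ^ 2 / t ^ 2)}

/-! ### The basic mean estimator -/

/-- The upper end `a_ℓ = 2^ℓ B / n` of the segment number `ℓ`. -/
noncomputable def upperEnd (n B : ℝ) (ℓ : ℕ) : ℝ :=
  2 ^ ℓ / n * B

/-- The lower end `a_{ℓ-1}` of the segment number `ℓ`, where `a_{-1} = 0`. -/
noncomputable def lowerEnd (n B : ℝ) : ℕ → ℝ
  | 0 => 0
  | ℓ + 1 => upperEnd n B ℓ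

open Classical in
/-- The scaled segment `(X / a_ℓ) 1_{a_{ℓ-1} ≤ X < a_ℓ}` of `X`. -/
noncomputable def scaledSegment {Ω : Type} (X : Ω → ℝ) (n B : ℝ) (ℓ : ℕ) (ω : Ω) : ℝ :=
  if lowerEnd n B ℓ ≤ X ω ∧ X ω < upperEnd n B ℓ then X ω / upperEnd n B ℓ else 0

/-- The index of the last segment, the integer part of `log₂ (1 / δ)`. -/
noncomputable def lastSegment (δ : ℝ) : ℕ :=
  ⌊lgInv δ⌋₊

/-- The basic mean estimator: estimate the mean of each scaled segment `0 ≤ ℓ ≤ ⌊log₂ (1/δ)⌋` with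
`QME (t, δ)`, where `t = c n √(log₂ (1/δ))`, and output `∑ ℓ, a_ℓ μ̂_ℓ`. -/
noncomputable def QBME (QME : MeanEstimator) {Ω G : Type} [Fintype Ω] [DecidableEq Ω] [Fintype G]
    [DecidableEq G] (z : Ω × G) (X : Ω → ℝ) (n c B δ : ℝ) : QueryAlg (Ω × G) :=
  QueryAlg.weightedSum (upperEnd n B)
    (fun ℓ => QME Ω G z (scaledSegment X n B ℓ) (c * n * Real.sqrt (lgInv δ)) δ) (lastSegment δ + 1)

/-! The estimator may be chosen, so one stronger than a general Quantum Monte Carlo estimator is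
built: `amplitudeMeanEstimator` has error at most `min (E Y) (√(E Y) log(1/δ) / (2t))` and failure
probability at most `δ ^ 2` (`prob_amplitudeMeanEstimator_ge`). The additive term in `1 / t ^ 2` is
gone, the error never exceeds the mean itself, and about `log(1/δ)` successive calls still fail with
total probability at most `δ`.

The estimator is amplitude estimation. Rotating a flag by `arcsin √(Y ω)` turns the oracle into a
state with flagged weight `E Y = sin² θ`; `j` Grover steps rotate it to angle `(2j+1)θ`
(`slice_finalState`). The counter `j` is weighted by a triangular window and Fourier transformed.
Since the window vanishes at both ends, summation by parts and Parseval bound the second moment of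
the angular error (`sum_norm_sq_dft_mul_sin_sq`), so a Chebyshev argument gives constant success
probability (`sum_isFar_le`). A majority vote amplifies it (`le_prob_repeatRun`), and values too
small to be resolved are replaced by `0`, which keeps the error below the mean (`threshold_error`).

For the segments (`segment_error_le`), write `L = log(1/δ)`. The lowest one costs at most `B√L /
(2n²)`. On any other segment starting below `B`, `a_ℓ X ≤ 4 B^(1-v) X^(1+v)`, and Cauchy–Schwarz
over at most `L` segments gives `√(u B^(1-v)) L / n`. On a segment starting at or above `B`, the
error is at most the mass of that segment; together with the mass above all segments this is part of
`E[X; X ≥ B] ≤ u / B^v`. -/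

/-! ### Composition of query algorithms -/

namespace QueryAlg

variable {S : Type} [Fintype S] [DecidableEq S]

theorem prob_nonneg (U : Matrix.unitaryGroup S ℂ) (E : Set ℝ) (A : QueryAlg S) :
    0 ≤ A.prob U E := by
  induction A with
  | output x => exact Set.indicator_nonneg (fun _ _ => zero_le_one) x
  | run C next ih =>
    exact Finset.sum_nonneg fun o _ => mul_nonneg (sq_nonneg _) (ih o)

theorem prob_mono (U : Matrix.unitaryGroup S ℂ) {E F : Set ℝ} (h : E ⊆ F) (A : QueryAlg S) :
    A.prob U E ≤ A.prob U F := by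
  induction A with
  | output x => exact Set.indicator_le_indicator_of_subset h (fun _ => zero_le_one) x
  | run C next ih =>
    exact Finset.sum_le_sum fun o _ => mul_le_mul_of_nonneg_left (ih o) (sq_nonneg _)

/-- Probabilities multiply along the branches of the decision tree. A bound on the continuation that
is uniform over the good outputs is all that is needed, so outputs outside `G` are simply discarded.
-/
theorem prob_mul_le_prob_bind (U : Matrix.unitaryGroup S ℂ) {G E : Set ℝ} {q : ℝ}
    (A : QueryAlg S) (f : ℝ → QueryAlg S) (h : ∀ x ∈ G, q ≤ (f x).prob U E) :
    A.prob U G * q ≤ (A.bind f).prob U E := by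
  induction A with
  | output x =>
    by_cases hx : x ∈ G
    · simpa [prob, bind, hx] using h x hx
    · simpa [prob, bind, hx] using prob_nonneg U E (f x)
  | run C next ih =>
    simp only [prob, bind, Finset.sum_mul]
    refine Finset.sum_le_sum fun o _ => ?_
    rw [mul_assoc]
    exact mul_le_mul_of_nonneg_left (ih o) (sq_nonneg _)

theorem queries_bind_le {q : ℕ} (A : QueryAlg S) (f : ℝ → QueryAlg S)
    (h : ∀ x, (f x).queries ≤ q) : (A.bind f).queries ≤ A.queries + q := by
  induction A with
  | output x => simpa [queries, bind] using h x
  | run C next ih =>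
    simp only [queries, bind, add_assoc]
    refine Nat.add_le_add_left (Finset.sup_le fun o _ => (ih o).trans ?_) _
    exact Nat.add_le_add_right (Finset.le_sup (f := fun o => (next o).queries) (Finset.mem_univ o)) _

theorem queries_weightedSum_le (a : ℕ → ℝ) (A : ℕ → QueryAlg S) {q : ℕ}
    (h : ∀ ℓ, (A ℓ).queries ≤ q) (m : ℕ) : (weightedSum a A m).queries ≤ m * q := by
  induction m with
  | zero => simp [weightedSum, queries]
  | succ m ih =>
    have hb : ∀ s : ℝ, ((A m).bind fun x => output (s + a m * x)).queries ≤ q := fun s =>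
      (queries_bind_le (q := 0) _ _ fun x => by simp [queries]).trans (h m)
    have := queries_bind_le (weightedSum a A m) _ hb
    simp only [weightedSum]
    rw [Nat.succ_mul]
    omega

theorem pow_le_prob_weightedSum (U : Matrix.unitaryGroup S ℂ) {a : ℕ → ℝ} (ha : ∀ ℓ, 0 ≤ a ℓ)
    (A : ℕ → QueryAlg S) {y e : ℕ → ℝ} {q : ℝ} (hq : 0 ≤ q)
    (h : ∀ ℓ, q ≤ (A ℓ).prob U {x | |x - y ℓ| ≤ e ℓ}) (m : ℕ) :
    q ^ m ≤ (weightedSum a A m).prob U {x | |x - ∑ ℓ ∈ Finset.range m, a ℓ * y ℓ| ≤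
      ∑ ℓ ∈ Finset.range m, a ℓ * e ℓ} := by
  induction m with
  | zero => simp [weightedSum, prob]
  | succ m ih =>
    rw [pow_succ]
    refine (mul_le_mul_of_nonneg_right ih hq).trans ?_
    refine prob_mul_le_prob_bind U _ _ fun s hs => ?_
    have key := prob_mul_le_prob_bind U (q := 1) (A m) (fun x => output (s + a m * x))
      (G := {x | |x - y m| ≤ e m}) (E := {x | |x - ∑ ℓ ∈ Finset.range (m + 1), a ℓ * y ℓ| ≤
        ∑ ℓ ∈ Finset.range (m + 1), a ℓ * e ℓ}) fun x hx => by
          have hmem : s + a m * x ∈ {x | |x - ∑ ℓ ∈ Finset.range (m + 1), a ℓ * y ℓ| ≤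
              ∑ ℓ ∈ Finset.range (m + 1), a ℓ * e ℓ} := by
            simp only [Set.mem_ofPred_eq, Finset.sum_range_succ] at hs hx ⊢
            have h1 : |a m * (x - y m)| ≤ a m * e m := by
              rw [abs_mul, abs_of_nonneg (ha m)]
              exact mul_le_mul_of_nonneg_left hx (ha m)
            calc _ = |(s - ∑ ℓ ∈ Finset.range m, a ℓ * y ℓ) + a m * (x - y m)| := by ring_nf
              _ ≤ _ := (abs_add_le _ _).trans (add_le_add hs h1)
          simp only [prob, Set.indicator_of_mem hmem, Pi.one_apply, le_refl]
    rw [mul_one] at key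
    exact (h m).trans key

/-! ### Amplification by majority vote -/

/-- Run the circuit `C` `R` times and output a function of the list of the measured data. -/
def repeatRun {D : Type} (C : Circuit S) (data : S × Fin C.dim → D) (post : List D → ℝ) :
    ℕ → List D → QueryAlg S
  | 0, l => output (post l)
  | R + 1, l => run C fun o => repeatRun C data post R (data o :: l)

theorem queries_repeatRun_le {D : Type} (C : Circuit S) (data : S × Fin C.dim → D)
    (post : List D → ℝ) (R : ℕ) (l : List D) :
    (repeatRun C data post R l).queries ≤ R * C.queries := by
  induction R generalizing l with
  | zero => simp [repeatRun, queries]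
  | succ R ih =>
    simp only [repeatRun, queries]
    have := Finset.sup_le (s := Finset.univ)
      (f := fun o => (repeatRun C data post R (data o :: l)).queries) fun o _ => ih (data o :: l)
    rw [Nat.succ_mul]
    omega

/-- A majority vote among outcomes that are bad with probability at most `1 / 16`: the weight
`2 ^ R * 16 ^ b / 4 ^ N`, for `b` bad outcomes so far and `R` remaining runs, bounds the probability
that at least half of the `N` outcomes are bad. -/
theorem le_prob_repeatRun {D : Type} (U : Matrix.unitaryGroup S ℂ) (C : Circuit S)
    (data : S × Fin C.dim → D) (post : List D → ℝ) (bad : D → Bool) (E : Set ℝ)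
    (hC : ∑ o, C.outcomeProb U o = 1)
    (hbad : (∑ o, if bad (data o) then C.outcomeProb U o else 0) ≤ 1 / 16)
    (N : ℕ) (hpost : ∀ l : List D, l.length = N → 2 * l.countP bad < N → post l ∈ E)
    (R : ℕ) (l : List D) (hl : R + l.length = N) :
    1 - 2 ^ R * 16 ^ (l.countP bad) / 4 ^ N ≤ (repeatRun C data post R l).prob U E := by
  induction R generalizing l with
  | zero =>
    by_cases hb : 2 * l.countP bad < N
    · have := hpost l (by omega) hb
      simp only [repeatRun, prob, Set.indicator_of_mem this, Pi.one_apply]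
      have : (0 : ℝ) ≤ 2 ^ 0 * 16 ^ (l.countP bad) / 4 ^ N := by positivity
      linarith
    · refine le_trans ?_ (prob_nonneg U E _)
      have : (4 : ℝ) ^ N ≤ 16 ^ (l.countP bad) := by
        calc (4 : ℝ) ^ N ≤ 4 ^ (2 * l.countP bad) := pow_le_pow_right₀ (by norm_num) (by omega)
          _ = _ := by rw [pow_mul]; norm_num
      rw [pow_zero, one_mul, sub_nonpos, one_le_div (by positivity)]
      exact this
  | succ R ih =>
    simp only [repeatRun, prob]
    set w : ℝ := 2 ^ R * 16 ^ (l.countP bad) / 4 ^ N with hw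
    have hw0 : 0 ≤ w := by positivity
    -- A good run leaves the failure weight `w`, a bad one makes it `16 * w`. The average is at most
    -- `(1 + 15 / 16) * w`, below the allowed `2 * w`.
    have h1 : ∀ o, C.outcomeProb U o * (1 - w) -
        15 * w * (if bad (data o) then C.outcomeProb U o else 0) ≤
        C.outcomeProb U o * (repeatRun C data post R (data o :: l)).prob U E := by
      intro o
      have h2 := mul_le_mul_of_nonneg_left (ih (data o :: l) (by simp; omega))
        (show 0 ≤ C.outcomeProb U o from sq_nonneg _)
      refine le_trans (le_of_eq ?_) h2
      by_cases hb : bad (data o)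
      · simp only [hb, if_true, List.countP_cons_of_pos hb, pow_succ, hw]; ring
      · simp [hb, hw]
    refine le_trans ?_ (Finset.sum_le_sum fun o _ => h1 o)
    rw [Finset.sum_sub_distrib, ← Finset.sum_mul, ← Finset.mul_sum, hC]
    have h3 := mul_le_mul_of_nonneg_left hbad (show 0 ≤ 15 * w by positivity)
    have h4 : (2 : ℝ) ^ (R + 1) * 16 ^ (l.countP bad) / 4 ^ N = 2 * w := by rw [hw]; ring
    rw [h4]
    linarith

end QueryAlg

/-! ### Unitary building blocks -/

section UnitaryConstructions

open Matrix

theorem sum_norm_sq_mulVec {m : Type*} [Fintype m] [DecidableEq m] {V : Matrix m m ℂ}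
    (hV : V ∈ unitaryGroup m ℂ) (φ : m → ℂ) :
    ∑ i, ‖(V *ᵥ φ) i‖ ^ 2 = ∑ i, ‖φ i‖ ^ 2 := by
  have key : ∀ ξ : m → ℂ, ((∑ i, ‖ξ i‖ ^ 2 : ℝ) : ℂ) = star ξ ⬝ᵥ ξ := by
    intro ξ
    simp only [dotProduct, Pi.star_apply, Complex.star_def, Complex.ofReal_sum, Complex.ofReal_pow]
    exact Finset.sum_congr rfl fun i _ => (Complex.conj_mul' (ξ i)).symm
  apply Complex.ofReal_injective
  rw [key, key, star_mulVec, dotProduct_mulVec, vecMul_vecMul, ← star_eq_conjTranspose,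
    mem_unitaryGroup_iff'.1 hV, vecMul_one]

/-- A unit vector extends to an orthonormal basis. This provides the gate that loads the window into
the counter. -/
theorem exists_unitary_with_column {m : Type*} [Fintype m] [DecidableEq m] (w : m → ℂ)
    (hw : ∑ i, ‖w i‖ ^ 2 = 1) (j₀ : m) :
    ∃ P : unitaryGroup m ℂ, ∀ i, (P : Matrix m m ℂ) i j₀ = w i := by
  have hn : ‖(WithLp.toLp 2 w : EuclideanSpace ℂ m)‖ = 1 := by
    rw [EuclideanSpace.norm_eq]; simp [hw]
  have ho : Orthonormal ℂ (({j₀} : Set m).domRestrict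
      (fun _ : m => (WithLp.toLp 2 w : EuclideanSpace ℂ m))) := by
    constructor
    · intro i; exact hn
    · intro i j hij
      exact absurd (Subsingleton.elim i j) hij
  obtain ⟨b, hb⟩ := ho.exists_orthonormalBasis_extension_of_card_eq (by simp)
  refine ⟨⟨_, (EuclideanSpace.basisFun m ℂ).toMatrix_orthonormalBasis_mem_unitary b⟩, fun i => ?_⟩
  simp [Module.Basis.toMatrix_apply, hb j₀ rfl]

variable {m o : Type*} [Fintype m] [Fintype o]

theorem blockDiagonal_mem_unitary [DecidableEq m] [DecidableEq o] {M : o → Matrix m m ℂ} (hM : ∀ k, M k ∈ unitaryGroup m ℂ) :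
    blockDiagonal M ∈ unitaryGroup (m × o) ℂ := by
  rw [mem_unitaryGroup_iff, star_eq_conjTranspose, blockDiagonal_conjTranspose,
    ← blockDiagonal_mul]
  have : (fun k => M k * (M k)ᴴ) = 1 := funext fun k => by
    simpa [star_eq_conjTranspose] using mem_unitaryGroup_iff.1 (hM k)
  rw [this, blockDiagonal_one]

theorem blockDiagonal_mulVec_apply [DecidableEq o] (M : o → Matrix m m ℂ) (φ : m × o → ℂ) (i : m) (k : o) :
    (blockDiagonal M *ᵥ φ) (i, k) = (M k *ᵥ fun i' => φ (i', k)) i := by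
  simp [mulVec, dotProduct, Fintype.sum_prod_type, blockDiagonal_apply, ite_mul]

theorem one_kronecker_mulVec_apply [DecidableEq m] (P : Matrix o o ℂ) (φ : m × o → ℂ) (i : m) (k : o) :
    (kronecker (1 : Matrix m m ℂ) P *ᵥ φ) (i, k) = ∑ k', P k k' * φ (i, k') := by
  simp [mulVec, dotProduct, Fintype.sum_prod_type, one_apply, ite_mul]

theorem one_kronecker_mem_unitary [DecidableEq m] [DecidableEq o] {P : Matrix o o ℂ} (hP : P ∈ unitaryGroup o ℂ) :
    kronecker (1 : Matrix m m ℂ) P ∈ unitaryGroup (m × o) ℂ :=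
  kronecker_mem_unitary (one_mem _) hP

theorem kronecker_one_mem_unitary [DecidableEq m] [DecidableEq o] {P : Matrix o o ℂ} (hP : P ∈ unitaryGroup o ℂ) :
    kronecker P (1 : Matrix m m ℂ) ∈ unitaryGroup (o × m) ℂ :=
  kronecker_mem_unitary hP (one_mem _)

/-- The reflection that flips the sign of the basis states in `p`. -/
def signFlip [DecidableEq m] (p : m → Prop) [DecidablePred p] : Matrix m m ℂ :=
  diagonal fun x => if p x then -1 else 1

theorem signFlip_mem_unitary [DecidableEq m] (p : m → Prop) [DecidablePred p] :
    signFlip p ∈ unitaryGroup m ℂ := by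
  rw [mem_unitaryGroup_iff, star_eq_conjTranspose, signFlip, diagonal_conjTranspose,
    diagonal_mul_diagonal, ← diagonal_one]
  congr 1
  funext x
  by_cases h : p x <;> simp [h]

theorem signFlip_congr {m : Type*} [DecidableEq m] {p q : m → Prop} [DecidablePred p] [DecidablePred q]
    (h : ∀ x, p x ↔ q x) : signFlip p = signFlip q := by
  unfold signFlip
  simp only [h]

theorem submatrix_mem_unitary [DecidableEq m] [DecidableEq o] (e : o ≃ m) {V : Matrix m m ℂ} (hV : V ∈ unitaryGroup m ℂ) :
    V.submatrix e e ∈ unitaryGroup o ℂ := by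
  rw [mem_unitaryGroup_iff, star_eq_conjTranspose, conjTranspose_submatrix,
    submatrix_mul_equiv, ← star_eq_conjTranspose, mem_unitaryGroup_iff.1 hV, submatrix_one_equiv]

end UnitaryConstructions

/-! ### Circuits preserve total probability -/

theorem Gate.sum_norm_sq_apply {S : Type} [Fintype S] [DecidableEq S] {d : ℕ}
    (U : Matrix.unitaryGroup S ℂ) (g : Gate S d) (φ : S × Fin d → ℂ) :
    ∑ x, ‖g.apply U φ x‖ ^ 2 = ∑ x, ‖φ x‖ ^ 2 := by
  have key : ∀ (V : Matrix S S ℂ) (x : S × Fin d),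
      Matrix.mulVec (Matrix.kronecker V (1 : Matrix (Fin d) (Fin d) ℂ)) φ x =
        ∑ s, V x.1 s * φ (s, x.2) := by
    intro V x
    simp [Matrix.mulVec, dotProduct, Fintype.sum_prod_type,
      Matrix.one_apply, ite_mul]
  cases g with
  | unitary V => exact sum_norm_sq_mulVec V.2 φ
  | oracle =>
    rw [← sum_norm_sq_mulVec (kronecker_one_mem_unitary U.2) φ]
    exact Finset.sum_congr rfl fun x _ => by rw [key]; rfl
  | oracleInv =>
    rw [← sum_norm_sq_mulVec (kronecker_one_mem_unitary (star U).2) φ]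
    exact Finset.sum_congr rfl fun x _ => by rw [key]; rfl

theorem Circuit.sum_outcomeProb {S : Type} [Fintype S] [DecidableEq S] (C : Circuit S)
    (U : Matrix.unitaryGroup S ℂ) : ∑ o, C.outcomeProb U o = 1 := by
  have key : ∀ (l : List (Gate S C.dim)) (φ : S × Fin C.dim → ℂ),
      ∑ x, ‖l.foldl (fun φ g => g.apply U φ) φ x‖ ^ 2 = ∑ x, ‖φ x‖ ^ 2 := by
    intro l
    induction l with
    | nil => intro φ; rfl
    | cons g l ih => intro φ; rw [List.foldl_cons, ih, Gate.sum_norm_sq_apply]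
  rw [show (∑ o, C.outcomeProb U o) = _ from key C.gates _,
    Finset.sum_eq_single C.init (fun x _ hx => by simp [Pi.single_eq_of_ne hx]) (by simp)]
  simp

/-! ### Amplitude amplification controlled by a counter -/

section Circuit

open Matrix

variable {S : Type} [Fintype S] [DecidableEq S] {N : ℕ}

/-- The workspace consists of a flag qubit and a counter; collect the counter last. -/
def registerEquiv (S : Type) (N : ℕ) : S × Fin (2 * N) ≃ (Fin 2 × S) × Fin N where
  toFun x := (((finProdFinEquiv.symm x.2).1, x.1), (finProdFinEquiv.symm x.2).2)
  invFun y := (y.1.2, finProdFinEquiv (y.1.1, y.2))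
  left_inv x := Prod.ext rfl (finProdFinEquiv.apply_symm_apply x.2)
  right_inv y := by simp

/-- The component of a state at the counter value `j`. -/
def slice (φ : S × Fin (2 * N) → ℂ) (j : Fin N) : Fin 2 × S → ℂ :=
  fun x => φ ((registerEquiv S N).symm (x, j))

/-- A gate that acts on oracle register and flag, controlled by the counter. -/
def blockGate (M : Fin N → unitaryGroup (Fin 2 × S) ℂ) : Gate S (2 * N) :=
  .unitary ⟨(blockDiagonal fun j => (M j : Matrix (Fin 2 × S) (Fin 2 × S) ℂ)).submatrix
    (registerEquiv S N) (registerEquiv S N),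
    submatrix_mem_unitary _ (blockDiagonal_mem_unitary fun j => (M j).2)⟩

/-- A gate that acts on the counter. -/
def counterGate (S : Type) [Fintype S] [DecidableEq S] (P : unitaryGroup (Fin N) ℂ) :
    Gate S (2 * N) :=
  .unitary ⟨(kronecker (1 : Matrix (Fin 2 × S) (Fin 2 × S) ℂ) P.1).submatrix
    (registerEquiv S N) (registerEquiv S N),
    submatrix_mem_unitary _ (one_kronecker_mem_unitary P.2)⟩

theorem slice_blockGate (U : unitaryGroup S ℂ) (M : Fin N → unitaryGroup (Fin 2 × S) ℂ)
    (φ : S × Fin (2 * N) → ℂ) (j : Fin N) :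
    slice ((blockGate M).apply U φ) j = (M j : Matrix (Fin 2 × S) (Fin 2 × S) ℂ) *ᵥ slice φ j := by
  funext x
  simp only [slice, blockGate, Gate.apply, submatrix_mulVec_equiv, Function.comp_apply,
    Equiv.apply_symm_apply]
  rw [blockDiagonal_mulVec_apply]
  rfl

theorem slice_counterGate (U : unitaryGroup S ℂ) (P : unitaryGroup (Fin N) ℂ)
    (φ : S × Fin (2 * N) → ℂ) (j : Fin N) (x : Fin 2 × S) :
    slice ((counterGate S P).apply U φ) j x = ∑ j', P.1 j j' * slice φ j' x := by
  simp only [slice, counterGate, Gate.apply, submatrix_mulVec_equiv, Function.comp_apply,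
    Equiv.apply_symm_apply]
  rw [one_kronecker_mulVec_apply]
  rfl

theorem slice_oracle (U : unitaryGroup S ℂ) (φ : S × Fin (2 * N) → ℂ) (j : Fin N) :
    slice (Gate.oracle.apply U φ) j =
      kronecker (1 : Matrix (Fin 2) (Fin 2) ℂ) U.1 *ᵥ slice φ j := by
  funext x
  obtain ⟨b, s⟩ := x
  rw [one_kronecker_mulVec_apply]
  rfl

theorem slice_oracleInv (U : unitaryGroup S ℂ) (φ : S × Fin (2 * N) → ℂ) (j : Fin N) :
    slice (Gate.oracleInv.apply U φ) j =
      kronecker (1 : Matrix (Fin 2) (Fin 2) ℂ) U.1ᴴ *ᵥ slice φ j := by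
  funext x
  obtain ⟨b, s⟩ := x
  rw [one_kronecker_mulVec_apply]
  rfl

/-- Rotate the flag by a unitary that is controlled by the oracle register. -/
def flagRotation (r : S → unitaryGroup (Fin 2) ℂ) : unitaryGroup (Fin 2 × S) ℂ :=
  ⟨blockDiagonal fun s => (r s : Matrix (Fin 2) (Fin 2) ℂ),
    blockDiagonal_mem_unitary fun s => (r s).2⟩

/-- The state preparation: a use of the oracle followed by the rotation of the flag. -/
def preparation (U : unitaryGroup S ℂ) (r : S → unitaryGroup (Fin 2) ℂ) :
    unitaryGroup (Fin 2 × S) ℂ :=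
  flagRotation r * ⟨kronecker (1 : Matrix (Fin 2) (Fin 2) ℂ) U.1, one_kronecker_mem_unitary U.2⟩

theorem preparation_mulVec_single (U : unitaryGroup S ℂ) (r : S → unitaryGroup (Fin 2) ℂ) (z : S) :
    (preparation U r).1 *ᵥ Pi.single (0, z) 1 = fun x => (r x.2).1 x.1 0 * U.1 x.2 z := by
  funext x
  obtain ⟨b, s⟩ := x
  change (((blockDiagonal fun s => (r s : Matrix (Fin 2) (Fin 2) ℂ)) *
    kronecker (1 : Matrix (Fin 2) (Fin 2) ℂ) U.1) *ᵥ _) (b, s) = _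
  rw [← mulVec_mulVec, blockDiagonal_mulVec_apply]
  simp only [one_kronecker_mulVec_apply]
  simp [mulVec, dotProduct, Pi.single_apply, Prod.ext_iff]

/-- Step number `i` of the amplitude amplification, active on the counter values above `i`. -/
def groverGates (z : S) (r : S → unitaryGroup (Fin 2) ℂ) (i : ℕ) : List (Gate S (2 * N)) :=
  -- Only the two reflections are controlled by the counter, as an oracle gate cannot be. Where they
  -- are inactive, the preparation cancels against its inverse.
  [blockGate fun j => ⟨_, signFlip_mem_unitary fun x => x.1 = 1 ∧ i < (j : ℕ)⟩,
   blockGate fun _ => star (flagRotation r), .oracleInv,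
   blockGate fun j => ⟨_, signFlip_mem_unitary fun x => x ≠ (0, z) ∧ i < (j : ℕ)⟩,
   .oracle, blockGate fun _ => flagRotation r]

/-- Amplitude amplification in superposition over the number of steps, followed by a unitary on the
counter. -/
def estimationCircuit (z : S) (j₀ : Fin N) (r : S → unitaryGroup (Fin 2) ℂ)
    (P F : unitaryGroup (Fin N) ℂ) : Circuit S where
  dim := 2 * N
  init := (registerEquiv S N).symm ((0, z), j₀)
  gates := [counterGate S P, .oracle, blockGate fun _ => flagRotation r] ++
    (List.range N).flatMap (groverGates z r) ++ [counterGate S F]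

theorem estimationCircuit_queries (z : S) (j₀ : Fin N) (r : S → unitaryGroup (Fin 2) ℂ)
    (P F : unitaryGroup (Fin N) ℂ) : (estimationCircuit z j₀ r P F).queries = 2 * N + 1 := by
  have h : ∀ n : ℕ, (((List.range n).flatMap (groverGates (N := N) z r)).map Gate.cost).sum =
      2 * n := by
    intro n
    induction n with
    | zero => rfl
    | succ n ih =>
      rw [List.range_succ, List.flatMap_append, List.map_append, List.sum_append, ih]
      simp [groverGates, blockGate, Gate.cost]
      ring
  have h' := h N
  simp only [Circuit.queries, estimationCircuit, List.map_append, List.sum_append, h']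
  simp [blockGate, counterGate, Gate.cost]
  ring

theorem slice_groverGates (U : unitaryGroup S ℂ) (z : S) (r : S → unitaryGroup (Fin 2) ℂ) (i : ℕ)
    (φ : S × Fin (2 * N) → ℂ) (j : Fin N) :
    slice ((groverGates z r i).foldl (fun φ g => g.apply U φ) φ) j =
      (preparation U r).1 *ᵥ (signFlip (fun x => x ≠ (0, z) ∧ i < (j : ℕ)) *ᵥ
        ((preparation U r).1ᴴ *ᵥ (signFlip (fun x => x.1 = 1 ∧ i < (j : ℕ)) *ᵥ slice φ j))) := by
  have h1 : (preparation U r).1 = (flagRotation r).1 * kronecker (1 : Matrix (Fin 2) (Fin 2) ℂ) U.1 :=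
    rfl
  have h2 : (kronecker (1 : Matrix (Fin 2) (Fin 2) ℂ) U.1)ᴴ =
      kronecker (1 : Matrix (Fin 2) (Fin 2) ℂ) U.1ᴴ := by
    have := conjTranspose_kronecker (1 : Matrix (Fin 2) (Fin 2) ℂ) U.1
    rw [conjTranspose_one] at this
    exact this
  simp only [groverGates, List.foldl_cons, List.foldl_nil, slice_blockGate, slice_oracle,
    slice_oracleInv, h1, conjTranspose_mul, h2, ← mulVec_mulVec]
  rfl

/-- The coefficients of the flagged and the unflagged part after `m` steps of amplitude
amplification. -/
noncomputable def groverCoeff (a : ℝ) : ℕ → Fin 2 → ℝ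
  | 0 => fun _ => 1
  | m + 1 => ![-2 * a * groverCoeff a m 1 + (1 - 2 * a) * groverCoeff a m 0,
      (1 - 2 * a) * groverCoeff a m 1 + 2 * (1 - a) * groverCoeff a m 0]

/-- Each step is a rotation by `2θ`, so this is the addition theorem. The coefficients are relative
to the initial amplitudes `sin θ` and `cos θ`; the recursion avoids dividing by them when one
vanishes. -/
theorem groverCoeff_sin_cos (θ : ℝ) (m : ℕ) :
    groverCoeff (Real.sin θ ^ 2) m 1 * Real.sin θ = Real.sin ((2 * m + 1) * θ) ∧
    groverCoeff (Real.sin θ ^ 2) m 0 * Real.cos θ = Real.cos ((2 * m + 1) * θ) := by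
  induction m with
  | zero => simp [groverCoeff]
  | succ m ih =>
    obtain ⟨h1, h2⟩ := ih
    have e : (2 * ((m + 1 : ℕ) : ℝ) + 1) * θ = (2 * m + 1) * θ + 2 * θ := by push_cast; ring
    rw [e, Real.sin_add, Real.cos_add, ← h1, ← h2, Real.sin_two_mul, Real.cos_two_mul,
      Real.cos_sq']
    simp only [groverCoeff, Matrix.cons_val_zero, Matrix.cons_val_one]
    have h3 := Real.sin_sq_add_cos_sq θ
    constructor
    · linear_combination (-2 * groverCoeff (Real.sin θ ^ 2) m 0 * Real.sin θ) * h3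
    · ring

/-- The conjugated reflection equals `2ΨΨ† - 1`, and together with the flag reflection it preserves
the plane spanned by the flagged and unflagged parts of `Ψ`. Only the inner product with `Ψ` has to
be computed. -/
theorem grover_step (A : unitaryGroup (Fin 2 × S) ℂ) (z : S) (Ψ : Fin 2 × S → ℂ) {a : ℝ}
    (hΨ : A.1 *ᵥ Pi.single (0, z) 1 = Ψ) (h1 : ∑ s, ‖Ψ (1, s)‖ ^ 2 = a)
    (h0 : ∑ s, ‖Ψ (0, s)‖ ^ 2 = 1 - a) (c : ℂ) (m : ℕ) :
    A.1 *ᵥ (signFlip (fun x => x ≠ (0, z)) *ᵥ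
        (A.1ᴴ *ᵥ (signFlip (fun x => x.1 = 1) *ᵥ fun x => c * groverCoeff a m x.1 * Ψ x))) =
      fun x => c * groverCoeff a (m + 1) x.1 * Ψ x := by
  set α := groverCoeff a m 1 with hα
  set β := groverCoeff a m 0 with hβ
  set χ : Fin 2 × S → ℂ := signFlip (fun x => x.1 = 1) *ᵥ fun x => c * groverCoeff a m x.1 * Ψ x
    with hχ
  have hχ' : ∀ x, χ x = (if x.1 = 1 then -1 else 1) * (c * groverCoeff a m x.1 * Ψ x) := by
    intro x; rw [hχ, signFlip, mulVec_diagonal]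
  set ξ := A.1ᴴ *ᵥ χ with hξ
  have hcol : ∀ x, A.1 x (0, z) = Ψ x := by
    intro x; rw [← hΨ, mulVec_single_one]; rfl
  have hsq : ∀ w : ℂ, star w * w = ((‖w‖ ^ 2 : ℝ) : ℂ) := by
    intro w; rw [Complex.ofReal_pow]; exact Complex.conj_mul' w
  have hξz : ξ (0, z) = c * (-α * a + β * (1 - a)) := by
    have e : ξ (0, z) = ∑ x, star (Ψ x) * χ x := by
      simp only [hξ, mulVec, dotProduct, conjTranspose_apply, hcol]
    have e1 : ∀ s, star (Ψ (1, s)) * χ (1, s) = -(c * α) * ((‖Ψ (1, s)‖ ^ 2 : ℝ) : ℂ) := by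
      intro s; rw [hχ', ← hsq]; simp [hα]; ring
    have e0 : ∀ s, star (Ψ (0, s)) * χ (0, s) = (c * β) * ((‖Ψ (0, s)‖ ^ 2 : ℝ) : ℂ) := by
      intro s; rw [hχ', ← hsq]; simp [hβ]; ring
    rw [e, Fintype.sum_prod_type, Fin.sum_univ_two]
    simp only [e0, e1, ← Finset.mul_sum, ← Complex.ofReal_sum, h0, h1]
    push_cast; ring
  -- Flipping every basis state except `(0, z)` is minus the identity plus twice the projection onto
  -- it.
  have hflip : signFlip (fun x => x ≠ (0, z)) *ᵥ ξ =
      -ξ + (2 * ξ (0, z)) • (Pi.single (0, z) 1 : Fin 2 × S → ℂ) := by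
    funext x
    rw [signFlip, mulVec_diagonal]
    by_cases hx : x = (0, z)
    · subst hx; simp; ring
    · simp [hx]
  rw [hflip, mulVec_add, mulVec_neg, mulVec_smul, hΨ, hξ, mulVec_mulVec, ← star_eq_conjTranspose,
    mem_unitaryGroup_iff.1 A.2, one_mulVec,
    star_eq_conjTranspose, ← hξ, hξz]
  funext x
  obtain ⟨b, s⟩ := x
  simp only [Pi.add_apply, Pi.neg_apply, Pi.smul_apply, smul_eq_mul, hχ', groverCoeff, ← hα, ← hβ]
  fin_cases b
  · simp [← hβ]; ring
  · simp [← hα]; ring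

theorem slice_finalState (U : unitaryGroup S ℂ) (z : S) (j₀ : Fin N)
    (r : S → unitaryGroup (Fin 2) ℂ) (P F : unitaryGroup (Fin N) ℂ) {a : ℝ}
    (h1 : ∑ s, ‖(r s).1 1 0 * U.1 s z‖ ^ 2 = a) (h0 : ∑ s, ‖(r s).1 0 0 * U.1 s z‖ ^ 2 = 1 - a)
    (y : Fin N) (x : Fin 2 × S) :
    slice ((estimationCircuit z j₀ r P F).finalState U) y x =
      (∑ j, F.1 y j * P.1 j j₀ * groverCoeff a j x.1) * ((r x.2).1 x.1 0 * U.1 x.2 z) := by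
  have hprep := preparation_mulVec_single U r z
  set Ψ : Fin 2 × S → ℂ := fun x => (r x.2).1 x.1 0 * U.1 x.2 z with hΨ
  set φ₀ : S × Fin (2 * N) → ℂ := [counterGate S P, .oracle, blockGate fun _ =>
    flagRotation r].foldl (fun φ g => g.apply U φ)
      (Pi.single ((registerEquiv S N).symm ((0, z), j₀)) 1) with hφ₀
  have hstart : ∀ j, slice φ₀ j = fun x => P.1 j j₀ * Ψ x := by
    intro j
    have e : slice ((counterGate S P).apply U
        (Pi.single ((registerEquiv S N).symm ((0, z), j₀)) 1)) j =
        P.1 j j₀ • (Pi.single (0, z) 1 : Fin 2 × S → ℂ) := by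
      funext x
      have hsl : ∀ j', slice (Pi.single ((registerEquiv S N).symm ((0, z), j₀)) 1) j' x =
          if x = (0, z) ∧ j' = j₀ then (1 : ℂ) else 0 := by
        intro j'
        simp only [slice, Pi.single_apply, EmbeddingLike.apply_eq_iff_eq, Prod.mk.injEq]
      rw [slice_counterGate]
      refine (Finset.sum_congr rfl fun j' _ => congrArg _ (hsl j')).trans ?_
      by_cases hx : x = (0, z) <;> simp [hx]
    have e2 : (flagRotation r).1 *ᵥ (kronecker (1 : Matrix (Fin 2) (Fin 2) ℂ) U.1 *ᵥ
        (Pi.single (0, z) 1 : Fin 2 × S → ℂ)) = Ψ := by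
      rw [mulVec_mulVec]; exact hprep
    rw [hφ₀, List.foldl_cons, List.foldl_cons, List.foldl_cons, List.foldl_nil, slice_blockGate,
      slice_oracle, e, mulVec_smul, mulVec_smul, e2]
    rfl
  -- Step `i` acts on the counter value `j` only if `i < j`, so after `n` steps `min n j` of them
  -- have acted; for `n = N` this is exactly `j`.
  have hgrover : ∀ n : ℕ, ∀ j : Fin N,
      slice (((List.range n).flatMap (groverGates z r)).foldl (fun φ g => g.apply U φ) φ₀) j =
        fun x => P.1 j j₀ * groverCoeff a (min n j) x.1 * Ψ x := by
    intro n
    induction n with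
    | zero => intro j; simp [hstart, groverCoeff]
    | succ n ih =>
      intro j
      rw [List.range_succ, List.flatMap_append, List.foldl_append, List.flatMap_singleton,
        slice_groverGates, ih j]
      by_cases hj : n < (j : ℕ)
      · rw [min_eq_left hj.le, min_eq_left (Nat.succ_le_of_lt hj)]
        have f1 : signFlip (fun x : Fin 2 × S => x.1 = 1 ∧ n < (j : ℕ)) =
            signFlip fun x => x.1 = 1 := signFlip_congr fun x => and_iff_left hj
        have f2 : signFlip (fun x : Fin 2 × S => x ≠ (0, z) ∧ n < (j : ℕ)) =
            signFlip fun x => x ≠ (0, z) := signFlip_congr fun x => and_iff_left hj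
        rw [f1, f2]
        exact grover_step _ z Ψ hprep h1 h0 _ n
      · rw [min_eq_right (not_lt.1 hj), min_eq_right ((not_lt.1 hj).trans (Nat.le_succ n))]
        have e : ∀ p : Fin 2 × S → Prop, ∀ [DecidablePred p], ∀ χ : Fin 2 × S → ℂ,
            (∀ x, ¬ p x) → signFlip p *ᵥ χ = χ := by
          intro p _ χ hp
          funext x
          rw [signFlip, mulVec_diagonal]
          simp [hp]
        rw [e _ _ (by simp [hj]), e _ _ (by simp [hj]), mulVec_mulVec, ← star_eq_conjTranspose,
          mem_unitaryGroup_iff.1 (preparation U r).2, one_mulVec]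
  have hfin : (estimationCircuit z j₀ r P F).finalState U = (counterGate S F).apply U
      (((List.range N).flatMap (groverGates z r)).foldl (fun φ g => g.apply U φ) φ₀) := by
    simp only [Circuit.finalState, estimationCircuit, List.foldl_append, hφ₀, List.foldl_cons,
      List.foldl_nil]
    rfl
  rw [hfin, slice_counterGate, Finset.sum_mul]
  refine Finset.sum_congr rfl fun j _ => ?_
  rw [hgrover, min_eq_right j.2.le]
  ring

/-- The probability of each measured value of the counter. -/
theorem sum_outcomeProb_counter (U : unitaryGroup S ℂ) (z : S) (j₀ : Fin N)
    (r : S → unitaryGroup (Fin 2) ℂ) (P F : unitaryGroup (Fin N) ℂ) (θ : ℝ)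
    (h1 : ∑ s, ‖(r s).1 1 0 * U.1 s z‖ ^ 2 = Real.sin θ ^ 2)
    (h0 : ∑ s, ‖(r s).1 0 0 * U.1 s z‖ ^ 2 = Real.cos θ ^ 2) (bad : Fin N → Bool) :
    (∑ o, if bad ((registerEquiv S N) o).2 then
        (estimationCircuit z j₀ r P F).outcomeProb U o else 0) =
      ∑ y, if bad y then
        ‖∑ j, F.1 y j * P.1 j j₀ * (Real.sin ((2 * (j : ℕ) + 1) * θ) : ℝ)‖ ^ 2 +
        ‖∑ j, F.1 y j * P.1 j j₀ * (Real.cos ((2 * (j : ℕ) + 1) * θ) : ℝ)‖ ^ 2 else 0 := by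
  have h0' : ∑ s, ‖(r s).1 0 0 * U.1 s z‖ ^ 2 = 1 - Real.sin θ ^ 2 := by rw [h0, Real.cos_sq']
  have hs := slice_finalState U z j₀ r P F h1 h0'
  have e : ∀ o : S × Fin (2 * N), (estimationCircuit z j₀ r P F).outcomeProb U o =
      ‖slice ((estimationCircuit z j₀ r P F).finalState U) ((registerEquiv S N) o).2
        ((registerEquiv S N) o).1‖ ^ 2 := by
    intro o
    simp only [slice, Prod.mk.eta, Equiv.symm_apply_apply]
    rfl
  calc _ = ∑ o : S × Fin (2 * N), (fun q : (Fin 2 × S) × Fin N => if bad q.2 then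
        ‖slice ((estimationCircuit z j₀ r P F).finalState U) q.2 q.1‖ ^ 2 else 0)
          ((registerEquiv S N) o) := Finset.sum_congr rfl fun o _ => by rw [e o]
    _ = ∑ q : (Fin 2 × S) × Fin N, if bad q.2 then
        ‖slice ((estimationCircuit z j₀ r P F).finalState U) q.2 q.1‖ ^ 2 else 0 :=
      Equiv.sum_comp (registerEquiv S N) fun q : (Fin 2 × S) × Fin N => if bad q.2 then
        ‖slice ((estimationCircuit z j₀ r P F).finalState U) q.2 q.1‖ ^ 2 else 0
    _ = _ := by
      rw [Fintype.sum_prod_type_right]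
      refine Finset.sum_congr rfl fun y _ => ?_
      by_cases hy : bad y
      · simp only [hy, if_true, hs, norm_mul, mul_pow]
        rw [Fintype.sum_prod_type, Fin.sum_univ_two]
        simp only [← Finset.mul_sum]
        simp only [norm_mul, mul_pow] at h1 h0
        rw [h0, h1]
        -- The weights `sin² θ` and `cos² θ` of the two flag sectors are absorbed into the squared
        -- sums, turning the relative coefficients into true sines and cosines.
        have k : ∀ (v : ℂ) (x : ℝ), ‖v‖ ^ 2 * x ^ 2 = ‖v * (x : ℂ)‖ ^ 2 := by
          intro v x; rw [norm_mul, mul_pow, Complex.norm_real, Real.norm_eq_abs, sq_abs]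
        rw [k, k, add_comm, Finset.sum_mul, Finset.sum_mul]
        have hm := groverCoeff_sin_cos θ
        congr 3 <;> refine Finset.sum_congr rfl fun j _ => ?_
        · rw [← (hm j).1]; push_cast; ring
        · rw [← (hm j).2]; push_cast; ring
      · simp [hy]

end Circuit

/-! ### Fourier analysis of the triangular window -/

section Window

open Matrix Complex

/-- The matrix of the discrete Fourier transform. -/
noncomputable def dftMatrix (N : ℕ) : Matrix (Fin N) (Fin N) ℂ :=
  fun y j => (Real.sqrt N : ℂ)⁻¹ * exp (-(2 * I * (Real.pi * (y : ℕ) / N : ℝ))) ^ (j : ℕ)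

theorem dftMatrix_mem_unitary (N : ℕ) : dftMatrix N ∈ unitaryGroup (Fin N) ℂ := by
  rw [mem_unitaryGroup_iff]
  ext y y'
  have hN : 0 < N := y.pos
  have hN' : (N : ℂ) ≠ 0 := by exact_mod_cast hN.ne'
  have hsq : (Real.sqrt N : ℂ)⁻¹ * (Real.sqrt N : ℂ)⁻¹ = (N : ℂ)⁻¹ := by
    rw [← mul_inv, ← ofReal_mul, Real.mul_self_sqrt (Nat.cast_nonneg N), ofReal_natCast]
  set x : ℂ := exp (2 * Real.pi * I * (((y' : ℕ) : ℂ) - ((y : ℕ) : ℂ)) / N) with hx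
  have hterm : ∀ j : Fin N, dftMatrix N y j * (star (dftMatrix N)) j y' = (N : ℂ)⁻¹ * x ^ (j : ℕ) := by
    intro j
    have hconj : star (exp (-(2 * I * (Real.pi * (y' : ℕ) / N : ℝ)))) =
        exp (2 * I * (Real.pi * (y' : ℕ) / N : ℝ)) := by
      rw [star_def, ← exp_conj]
      simp [map_ofNat]
    rw [star_apply, dftMatrix, dftMatrix, star_mul', star_pow, hconj, ← hsq]
    have : x = exp (-(2 * I * (Real.pi * (y : ℕ) / N : ℝ))) *
        exp (2 * I * (Real.pi * (y' : ℕ) / N : ℝ)) := by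
      rw [← exp_add, hx]; congr 1; push_cast; ring
    rw [this, mul_pow]
    simp only [star_def, map_inv₀, conj_ofReal]
    ring
  rw [mul_apply, Finset.sum_congr rfl fun j _ => hterm j, ← Finset.mul_sum,
    Fin.sum_univ_eq_sum_range (fun j => x ^ j) N]
  by_cases hyy : y = y'
  · subst hyy
    simp [hx, hN']
  · rw [one_apply_ne hyy]
    have hxN : x ^ N = 1 := by
      rw [hx, ← exp_nat_mul, exp_eq_one_iff]
      refine ⟨(y' : ℕ) - (y : ℕ), ?_⟩
      push_cast
      field_simp
    have hx1 : x ≠ 1 := by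
      intro h
      rw [hx, exp_eq_one_iff] at h
      obtain ⟨k, hk⟩ := h
      have hpi : (2 * Real.pi * I : ℂ) ≠ 0 := two_pi_I_ne_zero
      have h2 : (((y' : ℕ) : ℂ) - ((y : ℕ) : ℂ)) = k * N := by
        apply mul_left_cancel₀ hpi
        field_simp at hk ⊢
        linear_combination hk
      have h3 : ((y' : ℕ) : ℤ) - ((y : ℕ) : ℤ) = k * N := by exact_mod_cast h2
      have hy := y.2
      have hy' := y'.2
      -- Two counter values differ by less than `N`, so the only multiple of `N` available is `0`.
      have hk0 : k = 0 := by
        have l1 : k * (N : ℤ) < 1 * N := by omega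
        have l2 : (-1) * (N : ℤ) < k * N := by omega
        have hNz : (0 : ℤ) < N := by exact_mod_cast hN
        have := lt_of_mul_lt_mul_right l1 hNz.le
        have := lt_of_mul_lt_mul_right l2 hNz.le
        omega
      rw [hk0] at h3
      exact hyy (Fin.ext (by omega))
    have hg := geom_sum_mul x N
    rw [hxN, sub_self] at hg
    rw [(mul_eq_zero.1 hg).resolve_right (sub_ne_zero.2 hx1), mul_zero]

/-- Summation by parts. Truncated subtraction makes the difference at `j = 0` vanish, so that
boundary term appears separately as `w 0`. -/
theorem sub_one_mul_sum_range {R : Type*} [CommRing R] (w : ℕ → R) (x : R) (n : ℕ) :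
    (x - 1) * ∑ j ∈ Finset.range (n + 1), w j * x ^ j =
      ∑ j ∈ Finset.range (n + 1), (w (j - 1) - w j) * x ^ j + w n * x ^ (n + 1) - w 0 := by
  induction n with
  | zero => simp; ring
  | succ n ih =>
    rw [Finset.sum_range_succ, mul_add, ih, Finset.sum_range_succ _ (n + 1), Nat.add_sub_cancel]
    ring

/-- Up to a phase, the sum over `j` is a polynomial in `x = exp(2iτ)`, with `τ` the angular error,
and `|x - 1|² = 4 sin² τ`. Multiplying by `x - 1` differences the window without boundary terms, and
Parseval sums the result over `y`. -/
theorem sum_norm_sq_dft_mul_sin_sq {N : ℕ} (hN : 0 < N) (w : ℕ → ℝ) (h0 : w 0 = 0)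
    (h1 : w (N - 1) = 0) (θ : ℝ) :
    ∑ y : Fin N, ‖∑ j : Fin N, dftMatrix N y j * w j * exp (((2 * (j : ℕ) + 1) * θ : ℝ) * I)‖ ^ 2 *
        Real.sin (θ - Real.pi * (y : ℕ) / N) ^ 2 =
      1 / 4 * ∑ j ∈ Finset.range N, (w (j - 1) - w j) ^ 2 := by
  set D : Fin N → ℂ := fun j => ((w (j - 1) - w j : ℝ) : ℂ) * exp ((2 * (j : ℕ) * θ : ℝ) * I) with hD
  have hpars := sum_norm_sq_mulVec (dftMatrix_mem_unitary N) D
  have hR : ∑ j, ‖D j‖ ^ 2 = ∑ j ∈ Finset.range N, (w (j - 1) - w j) ^ 2 := by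
    rw [← Fin.sum_univ_eq_sum_range (fun j => (w (j - 1) - w j) ^ 2) N]
    refine Finset.sum_congr rfl fun j _ => ?_
    rw [hD]
    simp only [norm_mul, norm_exp_ofReal_mul_I, mul_one, norm_real, Real.norm_eq_abs, sq_abs]
  rw [← hR, ← hpars, Finset.mul_sum]
  refine Finset.sum_congr rfl fun y _ => ?_
  set τ : ℝ := θ - Real.pi * (y : ℕ) / N with hτ
  set x : ℂ := exp (I * (2 * τ : ℝ)) with hx
  have hnorm : ‖x - 1‖ ^ 2 = 4 * Real.sin τ ^ 2 := by
    rw [hx, norm_exp_I_mul_ofReal_sub_one, Real.norm_eq_abs, sq_abs]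
    rw [show 2 * τ / 2 = τ by ring]; ring
  have hpow : ∀ j : ℕ, exp (-(2 * I * (Real.pi * (y : ℕ) / N : ℝ))) ^ j *
      exp ((2 * (j : ℕ) * θ : ℝ) * I) = x ^ j := by
    intro j
    rw [hx, ← exp_nat_mul, ← exp_nat_mul, ← exp_add]
    congr 1
    rw [hτ]; push_cast; ring
  have e1 : ∑ j : Fin N, dftMatrix N y j * w j * exp (((2 * (j : ℕ) + 1) * θ : ℝ) * I) =
      exp (θ * I) * ((Real.sqrt N : ℂ)⁻¹ * ∑ j ∈ Finset.range N, (w j : ℂ) * x ^ j) := by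
    rw [← Fin.sum_univ_eq_sum_range (fun j => (w j : ℂ) * x ^ j) N, Finset.mul_sum, Finset.mul_sum]
    refine Finset.sum_congr rfl fun j _ => ?_
    have : exp (((2 * (j : ℕ) + 1) * θ : ℝ) * I) = exp ((2 * (j : ℕ) * θ : ℝ) * I) * exp (θ * I) := by
      rw [← exp_add]; congr 1; push_cast; ring
    rw [this, dftMatrix, ← hpow]
    ring
  have e2 : (dftMatrix N *ᵥ D) y = (Real.sqrt N : ℂ)⁻¹ *
      ∑ j ∈ Finset.range N, ((w (j - 1) : ℂ) - w j) * x ^ j := by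
    rw [← Fin.sum_univ_eq_sum_range (fun j => ((w (j - 1) : ℂ) - w j) * x ^ j) N, Finset.mul_sum]
    change (∑ j, dftMatrix N y j * D j) = _
    refine Finset.sum_congr rfl fun j _ => ?_
    rw [hD, dftMatrix, ← hpow]
    push_cast
    ring
  obtain ⟨n, rfl⟩ : ∃ n, N = n + 1 := ⟨N - 1, by omega⟩
  have e3 := sub_one_mul_sum_range (fun j => (w j : ℂ)) x n
  rw [Nat.add_sub_cancel] at h1
  simp only [h0, h1, ofReal_zero, zero_mul, add_zero, sub_zero] at e3
  rw [e1, e2, ← e3]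
  simp only [norm_mul, norm_exp_ofReal_mul_I, one_mul, mul_pow]
  rw [hnorm]
  ring

/-- A triangular window that vanishes at both ends. -/
def triangle (m j : ℕ) : ℕ := min j (4 * m - 1 - j)

/-- The window is at least `m` on the middle half, which has `2 * m` points. -/
theorem sum_triangle_sq_ge (m : ℕ) :
    2 * (m : ℝ) ^ 3 ≤ ∑ j ∈ Finset.range (4 * m), (triangle m j : ℝ) ^ 2 := by
  have h1 : ∑ j ∈ Finset.Ico m (3 * m), (m : ℝ) ^ 2 ≤
      ∑ j ∈ Finset.Ico m (3 * m), (triangle m j : ℝ) ^ 2 := by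
    refine Finset.sum_le_sum fun j hj => ?_
    rw [Finset.mem_Ico] at hj
    have : m ≤ triangle m j := by unfold triangle; omega
    have : (m : ℝ) ≤ triangle m j := by exact_mod_cast this
    gcongr
  have h2 : ∑ j ∈ Finset.Ico m (3 * m), (triangle m j : ℝ) ^ 2 ≤
      ∑ j ∈ Finset.range (4 * m), (triangle m j : ℝ) ^ 2 := by
    refine Finset.sum_le_sum_of_subset_of_nonneg (fun j hj => ?_) fun _ _ _ => sq_nonneg _
    rw [Finset.mem_Ico] at hj
    rw [Finset.mem_range]; omega
  rw [Finset.sum_const, Nat.card_Ico, show 3 * m - m = 2 * m by omega, nsmul_eq_mul] at h1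
  push_cast at h1
  linarith [h1, h2]

/-- The normalized window. -/
noncomputable def window (m j : ℕ) : ℝ :=
  triangle m j / Real.sqrt (∑ i ∈ Finset.range (4 * m), (triangle m i : ℝ) ^ 2)

theorem sum_window_sq {m : ℕ} (hm : 0 < m) :
    ∑ j ∈ Finset.range (4 * m), window m j ^ 2 = 1 := by
  have h := sum_triangle_sq_ge m
  have hm' : (0 : ℝ) < m := by exact_mod_cast hm
  have hpos : 0 < ∑ i ∈ Finset.range (4 * m), (triangle m i : ℝ) ^ 2 :=
    lt_of_lt_of_le (by positivity) h
  simp only [window, div_pow, Real.sq_sqrt hpos.le]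
  rw [← Finset.sum_div, div_self hpos.ne']

/-- The unnormalized window has slope at most one, so the `4 * m` squared differences sum to at most
`4m / (2m³)`. -/
theorem sum_window_sub_sq_le {m : ℕ} (hm : 0 < m) :
    ∑ j ∈ Finset.range (4 * m), (window m (j - 1) - window m j) ^ 2 ≤ 2 / (m : ℝ) ^ 2 := by
  have h := sum_triangle_sq_ge m
  have hm' : (0 : ℝ) < m := by exact_mod_cast hm
  set H := ∑ i ∈ Finset.range (4 * m), (triangle m i : ℝ) ^ 2 with hH
  have hpos : 0 < H := lt_of_lt_of_le (by positivity) h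
  have hterm : ∀ j ∈ Finset.range (4 * m), (window m (j - 1) - window m j) ^ 2 ≤ 1 / H := by
    intro j _
    rw [window, window, ← hH, ← sub_div, div_pow, Real.sq_sqrt hpos.le]
    have h1 : triangle m (j - 1) ≤ triangle m j + 1 := by unfold triangle; omega
    have h2 : triangle m j ≤ triangle m (j - 1) + 1 := by unfold triangle; omega
    have h1' : (triangle m (j - 1) : ℝ) ≤ triangle m j + 1 := by exact_mod_cast h1
    have h2' : (triangle m j : ℝ) ≤ triangle m (j - 1) + 1 := by exact_mod_cast h2
    gcongr
    rw [sq_le_one_iff_abs_le_one, abs_le]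
    constructor <;> linarith
  refine (Finset.sum_le_sum hterm).trans ?_
  rw [Finset.sum_const, Finset.card_range, nsmul_eq_mul, mul_one_div, div_le_div_iff₀ hpos (by positivity)]
  push_cast
  nlinarith [h]

/-- Neither `θ` nor `-θ` is within `r` of the angle that the counter value `y` stands for. -/
def IsFar (m : ℕ) (r θ : ℝ) (y : Fin (4 * m)) : Prop :=
  r < |Real.sin (θ - Real.pi * (y : ℕ) / (4 * m : ℕ))| ∧
    r < |Real.sin (-θ - Real.pi * (y : ℕ) / (4 * m : ℕ))|

open Classical in
-- Chebyshev's inequality for the squared sine of the angular error: its second moment `1 / (2m²)`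
-- against the threshold `9 / m²` gives `1 / 18`.
theorem sum_isFar_le {m : ℕ} (hm : 0 < m) (θ : ℝ) :
    (∑ y : Fin (4 * m), if IsFar m (3 / m) θ y then
      ‖∑ j : Fin (4 * m), dftMatrix (4 * m) y j * window m j *
        (Real.sin ((2 * (j : ℕ) + 1) * θ) : ℝ)‖ ^ 2 +
      ‖∑ j : Fin (4 * m), dftMatrix (4 * m) y j * window m j *
        (Real.cos ((2 * (j : ℕ) + 1) * θ) : ℝ)‖ ^ 2 else 0) ≤ 1 / 16 := by
  have hm' : (0 : ℝ) < m := by exact_mod_cast hm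
  set N := 4 * m with hN
  set E : ℝ → Fin N → ℂ := fun θ y =>
    ∑ j : Fin N, dftMatrix N y j * window m j * exp (((2 * (j : ℕ) + 1) * θ : ℝ) * I) with hE
  have hkey : ∀ θ, ∑ y : Fin N, ‖E θ y‖ ^ 2 * Real.sin (θ - Real.pi * (y : ℕ) / N) ^ 2 ≤
      1 / (2 * (m : ℝ) ^ 2) := by
    intro θ
    rw [sum_norm_sq_dft_mul_sin_sq (by omega) (window m) (by simp [window, triangle])
      (by simp [window, triangle, hN])]
    have := sum_window_sub_sq_le hm
    calc _ ≤ 1 / 4 * (2 / (m : ℝ) ^ 2) := by gcongr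
      _ = _ := by field_simp; norm_num
  -- The sine and cosine sums combine into the exponential sums for `θ` and `-θ`. The parallelogram
  -- law removes their interference, so the outcome is an equal mixture of estimates of the two
  -- angles.
  have hpar : ∀ y : Fin N,
      ‖∑ j : Fin N, dftMatrix N y j * window m j * (Real.sin ((2 * (j : ℕ) + 1) * θ) : ℝ)‖ ^ 2 +
      ‖∑ j : Fin N, dftMatrix N y j * window m j * (Real.cos ((2 * (j : ℕ) + 1) * θ) : ℝ)‖ ^ 2 =
      1 / 2 * (‖E θ y‖ ^ 2 + ‖E (-θ) y‖ ^ 2) := by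
    intro y
    set A := ∑ j : Fin N, dftMatrix N y j * window m j * (Real.sin ((2 * (j : ℕ) + 1) * θ) : ℝ)
    set B := ∑ j : Fin N, dftMatrix N y j * window m j * (Real.cos ((2 * (j : ℕ) + 1) * θ) : ℝ)
    have e1 : E θ y = B + A * I := by
      simp only [hE, A, B, Finset.sum_mul, ← Finset.sum_add_distrib]
      refine Finset.sum_congr rfl fun j _ => ?_
      rw [exp_mul_I, ← ofReal_cos, ← ofReal_sin]; ring
    have e2 : E (-θ) y = B - A * I := by
      simp only [hE, A, B, Finset.sum_mul, ← Finset.sum_sub_distrib]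
      refine Finset.sum_congr rfl fun j _ => ?_
      rw [mul_neg, exp_mul_I, ← ofReal_cos, ← ofReal_sin, Real.cos_neg, Real.sin_neg]
      push_cast; ring
    have := parallelogram_law_with_norm ℝ B (A * I)
    rw [e1, e2]
    simp only [norm_mul, norm_I, mul_one] at this
    nlinarith [this]
  have hterm : ∀ y : Fin N, (if IsFar m (3 / m) θ y then
      ‖∑ j : Fin N, dftMatrix N y j * window m j * (Real.sin ((2 * (j : ℕ) + 1) * θ) : ℝ)‖ ^ 2 +
      ‖∑ j : Fin N, dftMatrix N y j * window m j * (Real.cos ((2 * (j : ℕ) + 1) * θ) : ℝ)‖ ^ 2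
      else 0) ≤ (m : ℝ) ^ 2 / 18 * (‖E θ y‖ ^ 2 * Real.sin (θ - Real.pi * (y : ℕ) / N) ^ 2 +
        ‖E (-θ) y‖ ^ 2 * Real.sin (-θ - Real.pi * (y : ℕ) / N) ^ 2) := by
    intro y
    split_ifs with hfar
    · rw [hpar]
      have hb : ∀ {s : ℝ}, 3 / (m : ℝ) < |s| → 1 ≤ (m : ℝ) ^ 2 / 9 * s ^ 2 := by
        intro s hs
        have h3 : 3 < m * |s| := by rwa [div_lt_iff₀ hm', mul_comm] at hs
        have : (3 : ℝ) ^ 2 ≤ (m * |s|) ^ 2 := by gcongr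
        rw [mul_pow, sq_abs] at this
        linarith
      have b1 := mul_le_mul_of_nonneg_left (hb hfar.1) (sq_nonneg ‖E θ y‖)
      have b2 := mul_le_mul_of_nonneg_left (hb hfar.2) (sq_nonneg ‖E (-θ) y‖)
      linarith
    · positivity
  refine (Finset.sum_le_sum fun y _ => hterm y).trans ?_
  rw [← Finset.mul_sum, Finset.sum_add_distrib]
  have := add_le_add (hkey θ) (hkey (-θ))
  calc _ ≤ (m : ℝ) ^ 2 / 18 * (1 / (2 * (m : ℝ) ^ 2) + 1 / (2 * (m : ℝ) ^ 2)) := by gcongr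
    _ = 1 / 18 := by field_simp; norm_num
    _ ≤ _ := by norm_num

end Window

/-! ### Logarithms and expectations -/

theorem one_le_lgInv {δ : ℝ} (h0 : 0 < δ) (h : δ ≤ 1 / 2) : 1 ≤ lgInv δ := by
  rw [lgInv, Real.le_logb_iff_rpow_le one_lt_two (by positivity), Real.rpow_one,
    le_div_iff₀ h0]
  linarith

theorem two_rpow_lgInv {δ : ℝ} (h0 : 0 < δ) : (2 : ℝ) ^ lgInv δ = 1 / δ :=
  Real.rpow_logb two_pos (by norm_num) (by positivity)

theorem expect_nonneg {Ω : Type} [Fintype Ω] {p X : Ω → ℝ} (hp : p ∈ stdSimplex ℝ Ω) (hX : ∀ ω, 0 ≤ X ω) :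
    0 ≤ expect p X :=
  Finset.sum_nonneg fun ω _ => mul_nonneg (hp.1 ω) (hX ω)

theorem expect_mono {Ω : Type} [Fintype Ω] {p X Y : Ω → ℝ} (hp : p ∈ stdSimplex ℝ Ω) (h : ∀ ω, X ω ≤ Y ω) :
    expect p X ≤ expect p Y :=
  Finset.sum_le_sum fun ω _ => mul_le_mul_of_nonneg_left (h ω) (hp.1 ω)

theorem expect_const {Ω : Type} [Fintype Ω] {p : Ω → ℝ} (hp : p ∈ stdSimplex ℝ Ω) (c : ℝ) :
    expect p (fun _ => c) = c := by
  rw [expect, ← Finset.sum_mul, hp.2, one_mul]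

/-! ### The mean estimator -/

section Estimator

open Matrix

/-- The rotation of a qubit by the angle `φ`. -/
noncomputable def qubitRotation (φ : ℝ) : unitaryGroup (Fin 2) ℂ :=
  ⟨!![(Real.cos φ : ℂ), -(Real.sin φ : ℂ); (Real.sin φ : ℂ), (Real.cos φ : ℂ)], by
    have h : (Real.sin φ : ℂ) * Real.sin φ + Real.cos φ * Real.cos φ = 1 := by
      have := Real.sin_sq_add_cos_sq φ
      rw [sq, sq] at this
      exact_mod_cast this
    rw [mem_unitaryGroup_iff]
    ext i j
    fin_cases i <;> fin_cases j <;>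
      simp [mul_apply, Fin.sum_univ_two, -Complex.ofReal_sin, -Complex.ofReal_cos]
    · linear_combination h
    · ring
    · ring
    · exact h⟩

/-- The angle whose squared sine is `a`. -/
noncomputable def amplitudeAngle (a : ℝ) : ℝ :=
  Real.arcsin (Real.sqrt a)

theorem sin_amplitudeAngle {a : ℝ} (h1 : a ≤ 1) :
    Real.sin (amplitudeAngle a) = Real.sqrt a :=
  Real.sin_arcsin (by linarith [Real.sqrt_nonneg a]) (Real.sqrt_le_one.2 h1)

theorem sin_sq_amplitudeAngle {a : ℝ} (h0 : 0 ≤ a) (h1 : a ≤ 1) :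
    Real.sin (amplitudeAngle a) ^ 2 = a := by
  rw [sin_amplitudeAngle h1, Real.sq_sqrt h0]

theorem cos_sq_amplitudeAngle {a : ℝ} (h0 : 0 ≤ a) (h1 : a ≤ 1) :
    Real.cos (amplitudeAngle a) ^ 2 = 1 - a := by
  rw [Real.cos_sq', sin_sq_amplitudeAngle h0 h1]

theorem exists_windowPreparation {m : ℕ} (hm : 0 < m) :
    ∃ P : unitaryGroup (Fin (4 * m)) ℂ, ∀ j, P.1 j ⟨0, by omega⟩ = (window m j : ℂ) := by
  refine exists_unitary_with_column (fun j : Fin (4 * m) => (window m j : ℂ)) ?_ _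
  simp only [Complex.norm_real, Real.norm_eq_abs, sq_abs]
  rw [Fin.sum_univ_eq_sum_range (fun j => window m j ^ 2)]
  exact sum_window_sq hm

variable {Ω G : Type} [Fintype Ω] [DecidableEq Ω] [Fintype G] [DecidableEq G]

/-- Amplitude estimation for the mean of `Y`, with a counter of size `4 * m`. -/
noncomputable def amplitudeEstimation (z : Ω × G) (Y : Ω → ℝ) {m : ℕ} (hm : 0 < m) :
    Circuit (Ω × G) :=
  estimationCircuit z ⟨0, by omega⟩ (fun s => qubitRotation (amplitudeAngle (Y s.1)))
    (exists_windowPreparation hm).choose ⟨dftMatrix (4 * m), dftMatrix_mem_unitary _⟩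

/-- The measured value of the counter. -/
noncomputable def counterValue (z : Ω × G) (Y : Ω → ℝ) {m : ℕ} (hm : 0 < m)
    (o : (Ω × G) × Fin (amplitudeEstimation z Y hm).dim) : Fin (4 * m) :=
  (registerEquiv (Ω × G) (4 * m) o).2

/-- The unknown states `ψ ω` are normalized, hence drop out of every weight that depends on `ω`
alone. -/
theorem sum_norm_sq_oracle {z : Ω × G} {p : Ω → ℝ} {U : unitaryGroup (Ω × G) ℂ}
    (hp : p ∈ stdSimplex ℝ Ω) (hU : IsOracle U z p) (f : Ω → ℝ) :
    ∑ s : Ω × G, ‖(f s.1 : ℂ) * U.1 s z‖ ^ 2 = expect p fun ω => f ω ^ 2 := by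
  obtain ⟨ψ, h1, h2⟩ := hU
  rw [Fintype.sum_prod_type, expect]
  refine Finset.sum_congr rfl fun ω _ => ?_
  have : ∀ g, ‖(f ω : ℂ) * U.1 (ω, g) z‖ ^ 2 = (p ω * f ω ^ 2) * ‖ψ ω g‖ ^ 2 := by
    intro g
    rw [h2, norm_mul, norm_mul, Complex.norm_real, Complex.norm_real, mul_pow, mul_pow,
      Real.norm_eq_abs, Real.norm_eq_abs, sq_abs, sq_abs, Real.sq_sqrt (hp.1 ω)]
    ring
  simp only [this, ← Finset.mul_sum, h1, mul_one]

open Classical in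
theorem amplitudeEstimation_far_le {z : Ω × G} {Y : Ω → ℝ} (hY : ∀ ω, 0 ≤ Y ω ∧ Y ω ≤ 1)
    {p : Ω → ℝ} {U : unitaryGroup (Ω × G) ℂ} (hp : p ∈ stdSimplex ℝ Ω) (hU : IsOracle U z p)
    {m : ℕ} (hm : 0 < m) :
    (∑ o, if decide (IsFar m (3 / m) (amplitudeAngle (expect p Y)) (counterValue z Y hm o)) then
      (amplitudeEstimation z Y hm).outcomeProb U o else 0) ≤ 1 / 16 := by
  have ha0 : 0 ≤ expect p Y := expect_nonneg hp fun ω => (hY ω).1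
  have ha1 : expect p Y ≤ 1 := (expect_mono hp fun ω => (hY ω).2).trans_eq (expect_const hp 1)
  have h1 : ∑ s : Ω × G, ‖(qubitRotation (amplitudeAngle (Y s.1))).1 1 0 * U.1 s z‖ ^ 2 =
      Real.sin (amplitudeAngle (expect p Y)) ^ 2 := by
    rw [sin_sq_amplitudeAngle ha0 ha1]
    refine (sum_norm_sq_oracle hp hU fun ω => Real.sin (amplitudeAngle (Y ω))).trans ?_
    simp only [fun ω => sin_sq_amplitudeAngle (hY ω).1 (hY ω).2]
  have h0 : ∑ s : Ω × G, ‖(qubitRotation (amplitudeAngle (Y s.1))).1 0 0 * U.1 s z‖ ^ 2 =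
      Real.cos (amplitudeAngle (expect p Y)) ^ 2 := by
    rw [cos_sq_amplitudeAngle ha0 ha1]
    refine (sum_norm_sq_oracle hp hU fun ω => Real.cos (amplitudeAngle (Y ω))).trans ?_
    simp only [fun ω => cos_sq_amplitudeAngle (hY ω).1 (hY ω).2]
    simp only [expect, mul_sub, Finset.sum_sub_distrib, mul_one, hp.2]
  have key := sum_outcomeProb_counter U z (⟨0, by omega⟩ : Fin (4 * m))
    (fun s => qubitRotation (amplitudeAngle (Y s.1))) (exists_windowPreparation hm).choose
    ⟨dftMatrix (4 * m), dftMatrix_mem_unitary _⟩ _ h1 h0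
    (fun y => decide (IsFar m (3 / m) (amplitudeAngle (expect p Y)) y))
  refine key.trans_le ?_
  simp only [(exists_windowPreparation hm).choose_spec, decide_eq_true_eq]
  exact sum_isFar_le hm _

open Classical in
/-- Output a mean that is compatible with most of the outcomes, or `0` if it is too small to be
estimated up to a constant factor. -/
noncomputable def majorityEstimate (m : ℕ) (r : ℝ) (l : List (Fin (4 * m))) : ℝ :=
  if h : ∃ a : ℝ, 0 ≤ a ∧ a ≤ 1 ∧
      2 * l.countP (fun y => decide (IsFar m r (amplitudeAngle a) y)) < l.length then
    if h.choose < 121 * r ^ 2 then 0 else h.choose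
  else 0

/-- Pigeonhole: two sets of exceptions too small to cover the list leave a common good entry. It
links the estimate to the true mean. -/
theorem List.exists_mem_of_countP_lt {α : Type*} (P Q : α → Bool) (l : List α)
    (h : l.countP P + l.countP Q < l.length) : ∃ x ∈ l, ¬ P x ∧ ¬ Q x := by
  induction l with
  | nil => simp at h
  | cons x l ih =>
    by_cases hx : ¬ P x ∧ ¬ Q x
    · exact ⟨x, by simp, hx⟩
    · have h' : l.countP P + l.countP Q < l.length := by
        rw [List.countP_cons, List.countP_cons, List.length_cons] at h
        have : 1 ≤ (if P x = true then 1 else 0) + (if Q x = true then 1 else 0) := by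
          by_cases hP : P x = true <;> by_cases hQ : Q x = true <;> simp_all
        omega
      obtain ⟨y, hy, hy'⟩ := ih h'
      exact ⟨y, List.mem_cons_of_mem _ hy, hy'⟩

/-- The difference factors as `sin(s - t) sin(s + t)`. Both angles are near `η`, so the first factor
is at most `2r`; writing `s + t = 2s - (s - t)` controls the second. Only sines occur, so closeness
modulo `π` suffices. -/
theorem abs_sin_sq_sub_sin_sq_le {r s t η : ℝ} (hs : |Real.sin (s - η)| ≤ r)
    (ht : |Real.sin (t - η)| ≤ r) :
    |Real.sin s ^ 2 - Real.sin t ^ 2| ≤ 4 * r * (r + |Real.sin s|) := by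
  have hmul : ∀ x y : ℝ, |Real.sin x * Real.cos y| ≤ |Real.sin x| := by
    intro x y
    rw [abs_mul]
    exact mul_le_of_le_one_right (abs_nonneg _) (Real.abs_cos_le_one y)
  have hd : |Real.sin (s - t)| ≤ 2 * r := by
    have : s - t = (s - η) - (t - η) := by ring
    rw [this, Real.sin_sub, mul_comm (Real.cos _)]
    refine (abs_sub _ _).trans ?_
    linarith [hmul (s - η) (t - η), hmul (t - η) (s - η)]
  have hsum : |Real.sin (s + t)| ≤ 2 * |Real.sin s| + 2 * r := by
    have : s + t = 2 * s - (s - t) := by ring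
    rw [this, Real.sin_sub, mul_comm (Real.cos _)]
    refine (abs_sub _ _).trans ?_
    have h2 : |Real.sin (2 * s)| ≤ 2 * |Real.sin s| := by
      rw [Real.sin_two_mul, mul_assoc, abs_mul, abs_two]
      linarith [hmul s s]
    linarith [hmul (2 * s) (s - t), hmul (s - t) (2 * s)]
  have e : Real.sin s ^ 2 - Real.sin t ^ 2 = Real.sin (s - t) * Real.sin (s + t) := by
    rw [Real.sin_sub, Real.sin_add]
    linear_combination Real.sin t ^ 2 * Real.sin_sq_add_cos_sq s -
      Real.sin s ^ 2 * Real.sin_sq_add_cos_sq t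
  rw [e, abs_mul]
  calc _ ≤ (2 * r) * (2 * |Real.sin s| + 2 * r) :=
        mul_le_mul hd hsum (abs_nonneg _) ((abs_nonneg _).trans hd)
    _ = _ := by ring

theorem abs_sub_le_of_not_isFar {m : ℕ} {r a b : ℝ} {y : Fin (4 * m)} (ha0 : 0 ≤ a) (ha1 : a ≤ 1)
    (hb0 : 0 ≤ b) (hb1 : b ≤ 1) (ha : ¬ IsFar m r (amplitudeAngle a) y)
    (hb : ¬ IsFar m r (amplitudeAngle b) y) : |a - b| ≤ 4 * r * (r + Real.sqrt a) := by
  have key : ∀ c : ℝ, ¬ IsFar m r (amplitudeAngle c) y →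
      ∃ s, |Real.sin (s - Real.pi * (y : ℕ) / (4 * m : ℕ))| ≤ r ∧
        (s = amplitudeAngle c ∨ s = -amplitudeAngle c) := by
    intro c hc
    rw [IsFar, not_and_or, not_lt, not_lt] at hc
    rcases hc with hc | hc
    · exact ⟨_, hc, Or.inl rfl⟩
    · exact ⟨_, hc, Or.inr rfl⟩
  have hsin : ∀ c s : ℝ, 0 ≤ c → c ≤ 1 → (s = amplitudeAngle c ∨ s = -amplitudeAngle c) →
      |Real.sin s| = Real.sqrt c ∧ Real.sin s ^ 2 = c := by
    intro c s h0 h1 hs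
    have h : |Real.sin s| = Real.sqrt c := by
      rcases hs with rfl | rfl
      · rw [sin_amplitudeAngle h1, abs_of_nonneg (Real.sqrt_nonneg c)]
      · rw [Real.sin_neg, abs_neg, sin_amplitudeAngle h1, abs_of_nonneg (Real.sqrt_nonneg c)]
    exact ⟨h, by rw [← sq_abs, h, Real.sq_sqrt h0]⟩
  obtain ⟨s, hs, hs'⟩ := key a ha
  obtain ⟨t, ht, ht'⟩ := key b hb
  have := abs_sin_sq_sub_sin_sq_le hs ht
  rwa [(hsin a s ha0 ha1 hs').1, (hsin a s ha0 ha1 hs').2, (hsin b t hb0 hb1 ht').2] at this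

/-- The hypotheses give `√a ≤ √b + 2r` and `√b ≤ √a + 2r`. With threshold `√b < 11r`, a discarded
value has `√a ≤ 13r`, so the error `a` is at most `13r√a`. A retained value has `√a ≥ 9r`, which
makes `4r(r + √a)` at most `a` as well. -/
theorem threshold_error {r a b : ℝ} (hr : 0 ≤ r) (ha : 0 ≤ a) (hb : 0 ≤ b)
    (h1 : |a - b| ≤ 4 * r * (r + Real.sqrt a)) (h2 : |b - a| ≤ 4 * r * (r + Real.sqrt b)) :
    |(if b < 121 * r ^ 2 then 0 else b) - a| ≤ min a (13 * r * Real.sqrt a) := by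
  obtain ⟨x, hx, rfl⟩ : ∃ x, 0 ≤ x ∧ a = x ^ 2 :=
    ⟨_, Real.sqrt_nonneg a, (Real.sq_sqrt ha).symm⟩
  obtain ⟨y, hy, rfl⟩ : ∃ y, 0 ≤ y ∧ b = y ^ 2 :=
    ⟨_, Real.sqrt_nonneg b, (Real.sq_sqrt hb).symm⟩
  rw [Real.sqrt_sq hx] at h1 ⊢
  rw [Real.sqrt_sq hy] at h2
  split_ifs with h
  · have hy11 : y ≤ 11 * r := by
      refine (sq_le_sq₀ (by positivity) (by positivity)).1 ?_
      linarith [mul_pow 11 r 2]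
    have hxy : x ≤ y + 2 * r := by
      refine (sq_le_sq₀ (by positivity) (by positivity)).1 ?_
      have := (abs_le.1 h2).1
      nlinarith
    rw [zero_sub, abs_neg, abs_of_nonneg ha]
    refine le_min le_rfl ?_
    nlinarith
  · have hy11 : 11 * r ≤ y := by
      refine (sq_le_sq₀ (by positivity) hy).1 ?_
      linarith [mul_pow 11 r 2, not_lt.1 h]
    have hxy : y ≤ x + 2 * r := by
      refine (sq_le_sq₀ (by positivity) (by positivity)).1 ?_
      have := (abs_le.1 h1).1
      nlinarith
    have h9 : 9 * r ≤ x := by linarith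
    rw [abs_sub_comm]
    refine h1.trans (le_min ?_ ?_) <;> nlinarith

/-- The true mean is itself a candidate, so the search succeeds. Whichever candidate is chosen
shares a good outcome with the true mean, by pigeonhole. -/
theorem abs_majorityEstimate_sub_le {m : ℕ} {r a : ℝ} (hr : 0 ≤ r) (ha0 : 0 ≤ a) (ha1 : a ≤ 1)
    (l : List (Fin (4 * m))) (bad : Fin (4 * m) → Bool)
    (hbad : ∀ y, bad y = true ↔ IsFar m r (amplitudeAngle a) y)
    (hl : 2 * l.countP bad < l.length) :
    |majorityEstimate m r l - a| ≤ min a (13 * r * Real.sqrt a) := by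
  classical
  have e : bad = fun y => decide (IsFar m r (amplitudeAngle a) y) := by
    funext y
    rw [Bool.eq_iff_iff, hbad, decide_eq_true_iff]
  have h : ∃ a : ℝ, 0 ≤ a ∧ a ≤ 1 ∧
      2 * l.countP (fun y => decide (IsFar m r (amplitudeAngle a) y)) < l.length :=
    ⟨a, ha0, ha1, by rw [← e]; exact hl⟩
  obtain ⟨hb0, hb1, hb⟩ := h.choose_spec
  have e2 : majorityEstimate m r l = if h.choose < 121 * r ^ 2 then 0 else h.choose := by
    unfold majorityEstimate
    rw [dif_pos]
  rw [e2]
  generalize h.choose = b at hb0 hb1 hb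
  obtain ⟨y, -, hy1, hy2⟩ := List.exists_mem_of_countP_lt bad
    (fun y => decide (IsFar m r (amplitudeAngle b) y)) l (by omega)
  rw [hbad] at hy1
  rw [decide_eq_true_iff] at hy2
  exact threshold_error hr ha0 hb0 (abs_sub_le_of_not_isFar ha0 ha1 hb0 hb1 hy1 hy2)
    (abs_sub_le_of_not_isFar hb0 hb1 ha0 ha1 hy2 hy1)

/-- The majority vote of runs of amplitude estimation, with a counter of size `Θ(t / log (1 / δ))` and
`Θ(log (1 / δ))` repetitions. -/
noncomputable def amplitudeMeanEstimator : MeanEstimator :=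
  fun _ _ _ _ _ _ z Y t δ =>
    -- With radius `3 / m` the error is `39√a / m`. If `m ≥ 1`, then `156t / L < m + 1 ≤ 2m`, which
    -- brings it down to `√a L / (2t)`.
    if hm : 0 < ⌊156 * t / lgInv δ⌋₊ then
      QueryAlg.repeatRun (amplitudeEstimation z Y hm) (counterValue z Y hm)
        (majorityEstimate _ (3 / (⌊156 * t / lgInv δ⌋₊ : ℝ))) ⌈2 * lgInv δ⌉₊ []
    else QueryAlg.output 0

theorem queries_amplitudeMeanEstimator_le (z : Ω × G) (Y : Ω → ℝ) {t δ : ℝ} (ht : 0 < t)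
    (h0 : 0 < δ) (hδ : δ ≤ 1 / 2) :
    ((amplitudeMeanEstimator Ω G z Y t δ).queries : ℝ) ≤ 4212 * t := by
  have hL := one_le_lgInv h0 hδ
  set L := lgInv δ with hLdef
  have hL0 : 0 < L := by linarith
  unfold amplitudeMeanEstimator
  split_ifs with hm
  · have h1 := QueryAlg.queries_repeatRun_le (amplitudeEstimation z Y hm) (counterValue z Y hm)
      (majorityEstimate _ (3 / (⌊156 * t / L⌋₊ : ℝ))) ⌈2 * L⌉₊ []
    have hq : (amplitudeEstimation z Y hm).queries = 2 * (4 * ⌊156 * t / L⌋₊) + 1 :=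
      estimationCircuit_queries _ _ _ _ _
    rw [hq] at h1
    have h1' : ((QueryAlg.repeatRun (amplitudeEstimation z Y hm) (counterValue z Y hm)
      (majorityEstimate _ (3 / (⌊156 * t / L⌋₊ : ℝ))) ⌈2 * L⌉₊ []).queries : ℝ) ≤
        ⌈2 * L⌉₊ * (2 * (4 * ⌊156 * t / L⌋₊) + 1) := by exact_mod_cast h1
    refine h1'.trans ?_
    have h2 : (⌊156 * t / L⌋₊ : ℝ) ≤ 156 * t / L := Nat.floor_le (by positivity)
    have h3 : (⌈2 * L⌉₊ : ℝ) < 2 * L + 1 := Nat.ceil_lt_add_one (by positivity)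
    have h4 : (1 : ℝ) ≤ ⌊156 * t / L⌋₊ := by exact_mod_cast hm
    -- From `L ≥ 1` and `m ≥ 1`: at most `3L` repetitions of at most `9m` queries, and `27 * 156 =
    -- 4212`.
    calc (⌈2 * L⌉₊ : ℝ) * (2 * (4 * ⌊156 * t / L⌋₊) + 1) ≤ (3 * L) * (9 * (156 * t / L)) :=
          mul_le_mul (by linarith) (by linarith) (by positivity) (by positivity)
      _ = 4212 * t := by field_simp; norm_num
  · simp only [QueryAlg.queries, Nat.cast_zero]
    positivity

/-- The error is both smaller than the mean and at most half of the main term of the error of a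
Quantum Monte Carlo estimator, with probability `1 - δ ^ 2`. -/
theorem prob_amplitudeMeanEstimator_ge {z : Ω × G} {Y : Ω → ℝ} (hY : ∀ ω, 0 ≤ Y ω ∧ Y ω ≤ 1)
    {t δ : ℝ} (ht : 0 < t) (h0 : 0 < δ) (hδ : δ ≤ 1 / 2) {p : Ω → ℝ} {U : unitaryGroup (Ω × G) ℂ}
    (hp : p ∈ stdSimplex ℝ Ω) (hU : IsOracle U z p) :
    1 - δ ^ 2 ≤ (amplitudeMeanEstimator Ω G z Y t δ).prob U
      {y | |y - expect p Y| ≤ min (expect p Y) (1 / 2 * Real.sqrt (expect p Y) * lgInv δ / t)} := by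
  classical
  have ha0 : 0 ≤ expect p Y := expect_nonneg hp fun ω => (hY ω).1
  have ha1 : expect p Y ≤ 1 := (expect_mono hp fun ω => (hY ω).2).trans_eq (expect_const hp 1)
  set a := expect p Y with ha
  have hL := one_le_lgInv h0 hδ
  set L := lgInv δ with hLdef
  have hL0 : 0 < L := by linarith
  unfold amplitudeMeanEstimator
  split_ifs with hm
  · set m := ⌊156 * t / L⌋₊ with hmdef
    have hm1 : (1 : ℝ) ≤ m := by exact_mod_cast hm
    have key := QueryAlg.le_prob_repeatRun U (amplitudeEstimation z Y hm) (counterValue z Y hm)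
      (majorityEstimate m (3 / (m : ℝ)))
      (fun y => decide (IsFar m (3 / m) (amplitudeAngle a) y))
      {y | |y - a| ≤ min a (1 / 2 * Real.sqrt a * L / t)} (Circuit.sum_outcomeProb _ U)
      (amplitudeEstimation_far_le hY hp hU hm) ⌈2 * L⌉₊ (fun l hl hbad => by
        have h := abs_majorityEstimate_sub_le (r := 3 / (m : ℝ)) (by positivity) ha0 ha1 l
          (fun y => decide (IsFar m (3 / m) (amplitudeAngle a) y)) (fun y => decide_eq_true_iff)
          (by rw [hl]; exact hbad)
        refine h.trans (min_le_min_left _ ?_)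
        have hfl : 156 * t / L < m + 1 := Nat.lt_floor_add_one _
        have h2 : 78 * t ≤ m * L := by
          rw [div_lt_iff₀ hL0] at hfl
          nlinarith
        have h3 : 13 * (3 / (m : ℝ)) ≤ 1 / 2 * L / t := by
          rw [le_div_iff₀ ht, ← mul_div_assoc, div_mul_eq_mul_div, div_le_iff₀ (by linarith)]
          linarith
        calc 13 * (3 / (m : ℝ)) * Real.sqrt a ≤ 1 / 2 * L / t * Real.sqrt a := by gcongr
          _ = _ := by ring) ⌈2 * L⌉₊ [] (by simp)
    refine le_trans ?_ key
    -- The vote over `⌈2L⌉` runs fails with probability at most `2 ^ (-⌈2L⌉) ≤ δ ^ 2`.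
    have h4 : (1 / δ) ^ 2 ≤ (2 : ℝ) ^ ⌈2 * L⌉₊ := by
      rw [← two_rpow_lgInv h0, ← hLdef, ← Real.rpow_natCast, ← Real.rpow_mul zero_le_two,
        ← Real.rpow_natCast]
      refine Real.rpow_le_rpow_of_exponent_le one_le_two ?_
      have := Nat.le_ceil (2 * L)
      push_cast
      linarith
    have h5 : (4 : ℝ) ^ ⌈2 * L⌉₊ = 2 ^ ⌈2 * L⌉₊ * 2 ^ ⌈2 * L⌉₊ := by
      rw [← mul_pow]; norm_num
    rw [List.countP_nil, pow_zero, mul_one, h5, div_mul_cancel_left₀ (by positivity)]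
    have h6 : ((2 : ℝ) ^ ⌈2 * L⌉₊)⁻¹ ≤ δ ^ 2 := by
      rw [inv_le_comm₀ (by positivity) (by positivity)]
      rwa [one_div, inv_pow] at h4
    linarith
  -- Here `L / t > 156`, so the allowed error exceeds `√a ≥ a` and the output `0` is good enough
  -- without any query.
  · have hlt : 156 * t / L < 1 := by
      rw [Nat.floor_pos] at hm
      exact not_le.1 hm
    rw [div_lt_one hL0] at hlt
    have hmem : (0 : ℝ) ∈ {y | |y - a| ≤ min a (1 / 2 * Real.sqrt a * L / t)} := by
      rw [Set.mem_ofPred_eq, zero_sub, abs_neg, abs_of_nonneg ha0]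
      refine le_min le_rfl ?_
      rw [le_div_iff₀ ht]
      have hs : a ≤ Real.sqrt a := by
        refine Real.le_sqrt_of_sq_le ?_
        nlinarith
      have hs0 := Real.sqrt_nonneg a
      nlinarith
    simp only [QueryAlg.prob, Set.indicator_of_mem hmem, Pi.one_apply]
    nlinarith [sq_nonneg δ]

theorem isQuantumMonteCarlo_amplitudeMeanEstimator : IsQuantumMonteCarlo amplitudeMeanEstimator := by
  refine ⟨1, one_pos, 4212, by norm_num, ?_⟩
  intro Ω G _ _ _ _ z Y t δ hY ht h0 hδ
  refine ⟨queries_amplitudeMeanEstimator_le z Y ht h0 hδ, fun p U hp hU => ?_⟩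
  have h1 : 1 - δ ≤ 1 - δ ^ 2 := by nlinarith
  refine h1.trans ((prob_amplitudeMeanEstimator_ge hY ht h0 hδ hp hU).trans
    (QueryAlg.prob_mono U (fun y hy => ?_) _))
  have hL := one_le_lgInv h0 hδ
  have hy' : |y - expect p Y| ≤ min (expect p Y) (1 / 2 * Real.sqrt (expect p Y) * lgInv δ / t) := hy
  refine (hy'.trans (min_le_right _ _)).trans ?_
  have e1 : 0 ≤ Real.sqrt (expect p Y) * lgInv δ / t := by positivity
  have e2 : 0 ≤ lgInv δ ^ 2 / t ^ 2 := by positivity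
  calc _ = 1 / 2 * (Real.sqrt (expect p Y) * lgInv δ / t) := by ring
    _ ≤ _ := by linarith

end Estimator

/-! ### Error decomposition over the dyadic segments -/

section Segments

variable {n B : ℝ}

theorem upperEnd_pos (hn : 1 ≤ n) (hB : 0 < B) (ℓ : ℕ) : 0 < upperEnd n B ℓ := by
  unfold upperEnd; positivity

theorem upperEnd_succ (n B : ℝ) (ℓ : ℕ) : upperEnd n B (ℓ + 1) = 2 * upperEnd n B ℓ := by
  unfold upperEnd; ring

open Classical in
/-- The indicator function of the segment number `ℓ`. -/
noncomputable def segmentIndicator (n B : ℝ) (ℓ : ℕ) (x : ℝ) : ℝ :=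
  if lowerEnd n B ℓ ≤ x ∧ x < upperEnd n B ℓ then 1 else 0

theorem segmentIndicator_nonneg (n B : ℝ) (ℓ : ℕ) (x : ℝ) : 0 ≤ segmentIndicator n B ℓ x := by
  unfold segmentIndicator; split_ifs <;> norm_num

open Classical in
theorem sum_segmentIndicator (hn : 1 ≤ n) (hB : 0 < B) {x : ℝ} (hx : 0 ≤ x) (k : ℕ) :
    ∑ ℓ ∈ Finset.range (k + 1), segmentIndicator n B ℓ x =
      if x < upperEnd n B k then 1 else 0 := by
  induction k with
  | zero => simp [segmentIndicator, lowerEnd, hx]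
  | succ k ih =>
    have hlt : upperEnd n B k < upperEnd n B (k + 1) := by
      rw [upperEnd_succ]; linarith [upperEnd_pos hn hB k]
    rw [Finset.sum_range_succ, ih, segmentIndicator, lowerEnd]
    by_cases h1 : x < upperEnd n B k
    · simp [h1, h1.trans hlt, not_le.2 h1]
    · simp [h1, not_lt.1 h1]

theorem scaledSegment_eq {Ω : Type} (X : Ω → ℝ) (n B : ℝ) (ℓ : ℕ) (ω : Ω) :
    scaledSegment X n B ℓ ω = segmentIndicator n B ℓ (X ω) * X ω / upperEnd n B ℓ := by
  unfold scaledSegment segmentIndicator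
  split_ifs <;> simp

theorem scaledSegment_mem (hn : 1 ≤ n) (hB : 0 < B) {Ω : Type} {X : Ω → ℝ} (hX : ∀ ω, 0 ≤ X ω)
    (ℓ : ℕ) (ω : Ω) : 0 ≤ scaledSegment X n B ℓ ω ∧ scaledSegment X n B ℓ ω ≤ 1 := by
  have h := upperEnd_pos hn hB ℓ
  unfold scaledSegment
  split_ifs with hs
  · exact ⟨div_nonneg (hX ω) h.le, (div_le_one h).2 hs.2.le⟩
  · norm_num

theorem upperEnd_mul_expect_scaledSegment (hn : 1 ≤ n) (hB : 0 < B) {Ω : Type} [Fintype Ω]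
    (p X : Ω → ℝ) (ℓ : ℕ) :
    upperEnd n B ℓ * expect p (scaledSegment X n B ℓ) =
      expect p fun ω => segmentIndicator n B ℓ (X ω) * X ω := by
  have h := upperEnd_pos hn hB ℓ
  simp only [expect, Finset.mul_sum, scaledSegment_eq]
  refine Finset.sum_congr rfl fun ω _ => ?_
  field_simp

theorem expect_sum {Ω ι : Type} [Fintype Ω] (p : Ω → ℝ) (s : Finset ι) (X : ι → Ω → ℝ) :
    expect p (fun ω => ∑ i ∈ s, X i ω) = ∑ i ∈ s, expect p (X i) := by
  simp only [expect, Finset.mul_sum]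
  exact Finset.sum_comm

theorem expect_sub {Ω : Type} [Fintype Ω] (p X Y : Ω → ℝ) :
    expect p (fun ω => X ω - Y ω) = expect p X - expect p Y := by
  simp only [expect, mul_sub, Finset.sum_sub_distrib]

theorem expect_const_mul {Ω : Type} [Fintype Ω] (p X : Ω → ℝ) (c : ℝ) :
    expect p (fun ω => c * X ω) = c * expect p X := by
  simp only [expect, Finset.mul_sum]
  exact Finset.sum_congr rfl fun ω _ => by ring

variable {v : ℝ}

theorem le_rpow_one_add_div {x : ℝ} (hB : 0 < B) (hv : 0 < v) (hx : B ≤ x) :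
    x ≤ x ^ (1 + v) / B ^ v := by
  have hx0 : 0 < x := hB.trans_le hx
  rw [le_div_iff₀ (by positivity), Real.rpow_add hx0, Real.rpow_one]
  exact mul_le_mul_of_nonneg_left (Real.rpow_le_rpow hB.le hx hv.le) hx0.le

/-- On a segment whose lower end is positive and below `B`, the segment and the moment of order
`1 + v` control the second moment. -/
theorem upperEnd_mul_segment_le (hn : 1 ≤ n) (hB : 0 < B) (hv : 0 < v) (hv1 : v ≤ 1) {x : ℝ}
    {j : ℕ} (hj : upperEnd n B j < B) :
    upperEnd n B (j + 1) * (segmentIndicator n B (j + 1) x * x) ≤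
      4 * B ^ (1 - v) * (segmentIndicator n B (j + 1) x * x ^ (1 + v)) := by
  unfold segmentIndicator
  split_ifs with h
  · obtain ⟨h1, h2⟩ := h
    rw [lowerEnd] at h1
    rw [upperEnd_succ] at h2 ⊢
    have hx0 : 0 < x := (upperEnd_pos hn hB j).trans_le h1
    -- A segment starting below `B` may reach past `B`, but not past `2 * B`.
    have e1 : x ^ (1 - v) ≤ (2 * B) ^ (1 - v) :=
      Real.rpow_le_rpow hx0.le (by linarith) (by linarith)
    have e2 : (2 * B) ^ (1 - v) ≤ 2 * B ^ (1 - v) := by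
      rw [Real.mul_rpow two_pos.le hB.le]
      refine mul_le_mul_of_nonneg_right ?_ (by positivity)
      calc (2 : ℝ) ^ (1 - v) ≤ 2 ^ (1 : ℝ) :=
            Real.rpow_le_rpow_of_exponent_le one_le_two (by linarith)
        _ = 2 := Real.rpow_one 2
    have e3 : x ^ (1 + v) * x ^ (1 - v) = x * x := by
      rw [← Real.rpow_add hx0, show 1 + v + (1 - v) = ((2 : ℕ) : ℝ) by push_cast; ring,
        Real.rpow_natCast, sq]
    have hxv : 0 < x ^ (1 + v) := by positivity
    calc 2 * upperEnd n B j * (1 * x) ≤ 2 * x * x := by nlinarith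
      _ = 2 * (x ^ (1 + v) * x ^ (1 - v)) := by rw [e3]; ring
      _ ≤ 2 * (x ^ (1 + v) * (2 * B ^ (1 - v))) := by
        have := e1.trans e2
        gcongr
      _ = _ := by ring
  · simp

open Classical in
-- A point below `B` lies in exactly one segment, and that one starts below `B`, so nothing is lost.
-- A point from `B` on is charged entirely to the moment.
theorem sub_sum_segment_le (hn : 1 ≤ n) (hB : 0 < B) (hv : 0 < v) {x : ℝ} (hx : 0 ≤ x) {k : ℕ}
    (hk : B ≤ upperEnd n B k) :
    x - ∑ ℓ ∈ Finset.range (k + 1), (if lowerEnd n B ℓ < B then segmentIndicator n B ℓ x * x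
      else 0) ≤ x ^ (1 + v) / B ^ v := by
  by_cases hxB : B ≤ x
  · refine le_trans ?_ (le_rpow_one_add_div hB hv hxB)
    refine sub_le_self _ (Finset.sum_nonneg fun ℓ _ => ?_)
    split_ifs
    · exact mul_nonneg (segmentIndicator_nonneg _ _ _ _) hx
    · exact le_rfl
  · have e : ∀ ℓ, (if lowerEnd n B ℓ < B then segmentIndicator n B ℓ x * x else 0) =
        segmentIndicator n B ℓ x * x := by
      intro ℓ
      split_ifs with h
      · rfl
      · have : ¬ lowerEnd n B ℓ ≤ x := fun h' => hxB ((not_lt.1 h).trans h')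
        simp [segmentIndicator, this]
    simp only [e, ← Finset.sum_mul]
    rw [sum_segmentIndicator hn hB hx, if_pos ((not_le.1 hxB).trans_le hk), one_mul, sub_self]
    positivity

/-- The sum of the errors of the scaled segments and of the part of `X` that lies above them. -/
theorem segment_error_le {Ω : Type} [Fintype Ω] {p X : Ω → ℝ} {L u : ℝ} {k : ℕ}
    (hp : p ∈ stdSimplex ℝ Ω) (hX : ∀ ω, 0 ≤ X ω) (hn : 1 ≤ n) (hB : 0 < B) (hL : 1 ≤ L)
    (hkL : (k : ℝ) ≤ L) (hv : 0 < v) (hv1 : v ≤ 1)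
    (hu : expect p (fun ω => X ω ^ (1 + v)) ≤ u) (hk : B ≤ upperEnd n B k) {e : ℕ → ℝ}
    (he1 : ∀ ℓ, e ℓ ≤ expect p (scaledSegment X n B ℓ))
    (he2 : ∀ ℓ, e ℓ ≤ Real.sqrt (expect p (scaledSegment X n B ℓ)) * Real.sqrt L / (2 * n)) :
    expect p X - ∑ ℓ ∈ Finset.range (k + 1), upperEnd n B ℓ * expect p (scaledSegment X n B ℓ) +
        ∑ ℓ ∈ Finset.range (k + 1), upperEnd n B ℓ * e ℓ ≤
      Real.sqrt (u * B ^ (1 - v)) * L / n + B * Real.sqrt L / (2 * n ^ 2) + u / B ^ v := by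
  classical
  have hn0 : 0 < n := by linarith
  have hL0 : 0 < L := by linarith
  set I : ℕ → ℝ := fun ℓ => expect p fun ω => segmentIndicator n B ℓ (X ω) * X ω with hI
  set J : ℕ → ℝ := fun ℓ => expect p fun ω => segmentIndicator n B ℓ (X ω) * X ω ^ (1 + v) with hJ
  have hI' : ∀ ℓ, upperEnd n B ℓ * expect p (scaledSegment X n B ℓ) = I ℓ :=
    upperEnd_mul_expect_scaledSegment hn hB p X
  have hJ0 : ∀ ℓ, 0 ≤ J ℓ := fun ℓ => expect_nonneg hp fun ω =>
    mul_nonneg (segmentIndicator_nonneg _ _ _ _) (Real.rpow_nonneg (hX ω) _)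
  have hJsum : ∑ ℓ ∈ Finset.range (k + 1), J ℓ ≤ u := by
    refine le_trans ?_ hu
    rw [hJ, ← expect_sum]
    refine expect_mono hp fun ω => ?_
    rw [← Finset.sum_mul, sum_segmentIndicator hn hB (hX ω)]
    have := Real.rpow_nonneg (hX ω) (1 + v)
    split_ifs <;> linarith
  have hu0 : 0 ≤ u := (Finset.sum_nonneg fun ℓ _ => hJ0 ℓ).trans hJsum
  have hzero : upperEnd n B 0 * e 0 ≤ B * Real.sqrt L / (2 * n ^ 2) := by
    have h1 : expect p (scaledSegment X n B 0) ≤ 1 :=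
      (expect_mono hp fun ω => (scaledSegment_mem hn hB hX 0 ω).2).trans_eq (expect_const hp 1)
    have h2 : e 0 ≤ Real.sqrt L / (2 * n) := by
      refine (he2 0).trans ?_
      have := Real.sqrt_le_one.2 h1
      have h3 : Real.sqrt (expect p (scaledSegment X n B 0)) * Real.sqrt L ≤ Real.sqrt L :=
        mul_le_of_le_one_left (Real.sqrt_nonneg L) this
      gcongr
    calc upperEnd n B 0 * e 0 ≤ upperEnd n B 0 * (Real.sqrt L / (2 * n)) :=
          mul_le_mul_of_nonneg_left h2 (upperEnd_pos hn hB 0).le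
      _ = _ := by unfold upperEnd; field_simp
  have hlow : ∀ j, upperEnd n B j < B → upperEnd n B (j + 1) * e (j + 1) ≤
      Real.sqrt L / n * Real.sqrt (B ^ (1 - v)) * Real.sqrt (J (j + 1)) := by
    intro j hj
    have ha := upperEnd_pos hn hB (j + 1)
    have h1 : upperEnd n B (j + 1) * I (j + 1) ≤ 4 * B ^ (1 - v) * J (j + 1) := by
      rw [hI, hJ, ← expect_const_mul, ← expect_const_mul]
      exact expect_mono hp fun ω => upperEnd_mul_segment_le hn hB hv hv1 hj
    have h2 : upperEnd n B (j + 1) * Real.sqrt (expect p (scaledSegment X n B (j + 1))) ≤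
        2 * (Real.sqrt (B ^ (1 - v)) * Real.sqrt (J (j + 1))) := by
      have hBv : 0 ≤ B ^ (1 - v) := by positivity
      rw [← Real.sqrt_mul hBv]
      have e4 : (2 : ℝ) * Real.sqrt (B ^ (1 - v) * J (j + 1)) =
          Real.sqrt (4 * B ^ (1 - v) * J (j + 1)) := by
        rw [mul_assoc, Real.sqrt_mul (by norm_num : (0 : ℝ) ≤ 4), show (4 : ℝ) = 2 ^ 2 by norm_num,
          Real.sqrt_sq two_pos.le]
      have e5 : upperEnd n B (j + 1) * Real.sqrt (expect p (scaledSegment X n B (j + 1))) =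
          Real.sqrt (upperEnd n B (j + 1) * I (j + 1)) := by
        rw [← hI', ← mul_assoc, Real.sqrt_mul (by positivity), Real.sqrt_mul_self ha.le]
      rw [e4, e5]
      exact Real.sqrt_le_sqrt h1
    calc upperEnd n B (j + 1) * e (j + 1) ≤ upperEnd n B (j + 1) *
          (Real.sqrt (expect p (scaledSegment X n B (j + 1))) * Real.sqrt L / (2 * n)) :=
          mul_le_mul_of_nonneg_left (he2 _) ha.le
      _ = (upperEnd n B (j + 1) * Real.sqrt (expect p (scaledSegment X n B (j + 1)))) *
          (Real.sqrt L / (2 * n)) := by ring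
      _ ≤ (2 * (Real.sqrt (B ^ (1 - v)) * Real.sqrt (J (j + 1)))) * (Real.sqrt L / (2 * n)) :=
          mul_le_mul_of_nonneg_right h2 (by positivity)
      _ = _ := by field_simp
  -- Cauchy–Schwarz over `k ≤ L` disjoint segments, whose moments add up to at most `u`.
  have hcs : ∑ j ∈ Finset.range k, Real.sqrt (J (j + 1)) ≤ Real.sqrt L * Real.sqrt u := by
    rw [← Real.sqrt_mul hL0.le]
    refine Real.le_sqrt_of_sq_le (sq_sum_le_card_mul_sum_sq.trans ?_)
    rw [Finset.card_range]
    have h1 : ∑ j ∈ Finset.range k, Real.sqrt (J (j + 1)) ^ 2 ≤ u := by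
      simp only [Real.sq_sqrt (hJ0 _)]
      rw [Finset.sum_range_succ'] at hJsum
      linarith [hJ0 0]
    exact mul_le_mul hkL h1 (Finset.sum_nonneg fun _ _ => sq_nonneg _) hL0.le
  set b : ℝ := Real.sqrt L / n * Real.sqrt (B ^ (1 - v)) with hb
  have hb0 : 0 ≤ b := by positivity
  -- For a segment starting at or above `B`, the error is paid for by its own mass `I ℓ`. Summed,
  -- these masses cancel against the subtracted ones and leave only the segments below `B` in
  -- `htail`.
  have hterm : ∀ ℓ, upperEnd n B ℓ * e ℓ ≤ I ℓ - (if lowerEnd n B ℓ < B then I ℓ else 0) +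
      (if ℓ = 0 then B * Real.sqrt L / (2 * n ^ 2) else b * Real.sqrt (J ℓ)) := by
    intro ℓ
    by_cases h : lowerEnd n B ℓ < B
    · rw [if_pos h, sub_self, zero_add]
      cases ℓ with
      | zero => rw [if_pos rfl]; exact hzero
      | succ j => rw [if_neg (Nat.succ_ne_zero j)]; exact hlow j h
    · have h1 : upperEnd n B ℓ * e ℓ ≤ I ℓ := by
        rw [← hI']
        exact mul_le_mul_of_nonneg_left (he1 ℓ) (upperEnd_pos hn hB ℓ).le
      rw [if_neg h, sub_zero]
      refine h1.trans (le_add_of_nonneg_right ?_)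
      split_ifs <;> positivity
  have hsum := Finset.sum_le_sum fun ℓ (_ : ℓ ∈ Finset.range (k + 1)) => hterm ℓ
  rw [Finset.sum_add_distrib, Finset.sum_sub_distrib, Finset.sum_range_succ' (fun ℓ =>
    if ℓ = 0 then B * Real.sqrt L / (2 * n ^ 2) else b * Real.sqrt (J ℓ)) k] at hsum
  simp only [if_true, Nat.succ_ne_zero, if_false, ← Finset.mul_sum] at hsum
  have htail : expect p X - ∑ ℓ ∈ Finset.range (k + 1),
      (if lowerEnd n B ℓ < B then I ℓ else 0) ≤ u / B ^ v := by
    have e1 : ∀ ℓ, (if lowerEnd n B ℓ < B then I ℓ else 0) = expect p fun ω =>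
        if lowerEnd n B ℓ < B then segmentIndicator n B ℓ (X ω) * X ω else 0 := by
      intro ℓ
      split_ifs
      · rfl
      · simp [expect]
    simp only [e1]
    rw [← expect_sum, ← expect_sub]
    refine (expect_mono hp fun ω => sub_sum_segment_le hn hB hv (hX ω) hk).trans ?_
    simp only [div_eq_inv_mul]
    rw [expect_const_mul]
    exact mul_le_mul_of_nonneg_left hu (by positivity)
  have hmain : b * ∑ j ∈ Finset.range k, Real.sqrt (J (j + 1)) ≤
      Real.sqrt (u * B ^ (1 - v)) * L / n := by
    refine (mul_le_mul_of_nonneg_left hcs hb0).trans_eq ?_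
    rw [hb, Real.sqrt_mul hu0]
    have := Real.mul_self_sqrt hL0.le
    calc _ = Real.sqrt u * Real.sqrt (B ^ (1 - v)) * (Real.sqrt L * Real.sqrt L) / n := by ring
      _ = _ := by rw [this]
  simp only [hI']
  linarith

end Segments

/-! ### Guarantees of the basic mean estimator -/

theorem lastSegment_le {δ : ℝ} (h0 : 0 < δ) (hδ : δ ≤ 1 / 2) : (lastSegment δ : ℝ) ≤ lgInv δ :=
  Nat.floor_le (zero_le_one.trans (one_le_lgInv h0 hδ))

/-- Bernoulli's inequality leaves a failure of `(k + 1) δ²`, and `k + 1 ≤ 2 ^ k ≤ 1 / δ`. This is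
why each call is made to fail with probability only `δ ^ 2`. -/
theorem one_sub_le_pow_lastSegment {δ : ℝ} (h0 : 0 < δ) (hδ : δ ≤ 1 / 2) :
    1 - δ ≤ (1 - δ ^ 2) ^ (lastSegment δ + 1) := by
  have h1 := one_add_mul_le_pow (a := -δ ^ 2) (by nlinarith) (lastSegment δ + 1)
  have h2 : ((lastSegment δ + 1 : ℕ) : ℝ) ≤ 1 / δ := by
    rw [← two_rpow_lgInv h0]
    calc ((lastSegment δ + 1 : ℕ) : ℝ) ≤ 2 ^ lastSegment δ := by
          exact_mod_cast Nat.lt_two_pow_self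
      _ = (2 : ℝ) ^ (lastSegment δ : ℝ) := (Real.rpow_natCast _ _).symm
      _ ≤ _ := Real.rpow_le_rpow_of_exponent_le one_le_two (lastSegment_le h0 hδ)
  rw [le_div_iff₀ h0] at h2
  have h3 : (1 + -δ ^ 2) = 1 - δ ^ 2 := by ring
  rw [h3] at h1
  refine le_trans ?_ h1
  nlinarith

theorem queries_QBME_le {Ω G : Type} [Fintype Ω] [DecidableEq Ω] [Fintype G] [DecidableEq G]
    (z : Ω × G) (X : Ω → ℝ) {n δ : ℝ} (B : ℝ) (hn : 1 ≤ n) (h0 : 0 < δ) (hδ : δ ≤ 1 / 2) :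
    ((QBME amplitudeMeanEstimator z X n 1 B δ).queries : ℝ) ≤ 8424 * n * lgInv δ ^ (3 / 2 : ℝ) := by
  have hL := one_le_lgInv h0 hδ
  have hk := lastSegment_le h0 hδ
  set L := lgInv δ with hLdef
  have hL0 : 0 < L := by linarith
  have ht : 0 < 1 * n * Real.sqrt L := by positivity
  have h1 := QueryAlg.queries_weightedSum_le (upperEnd n B)
    (fun ℓ => amplitudeMeanEstimator Ω G z (scaledSegment X n B ℓ) (1 * n * Real.sqrt L) δ)
    (q := ⌊4212 * (1 * n * Real.sqrt L)⌋₊)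
    (fun ℓ => Nat.le_floor (queries_amplitudeMeanEstimator_le z _ ht h0 hδ)) (lastSegment δ + 1)
  have h2 : ((QBME amplitudeMeanEstimator z X n 1 B δ).queries : ℝ) ≤
      (lastSegment δ + 1) * ⌊4212 * (1 * n * Real.sqrt L)⌋₊ := by exact_mod_cast h1
  have h3 : (⌊4212 * (1 * n * Real.sqrt L)⌋₊ : ℝ) ≤ 4212 * (1 * n * Real.sqrt L) :=
    Nat.floor_le (by positivity)
  have h4 : L ^ (3 / 2 : ℝ) = L * Real.sqrt L := by
    rw [show (3 / 2 : ℝ) = 1 + 1 / 2 by norm_num, Real.rpow_add hL0, Real.rpow_one,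
      ← Real.sqrt_eq_rpow]
  calc _ ≤ (2 * L) * (4212 * (1 * n * Real.sqrt L)) :=
        h2.trans (mul_le_mul (by linarith) h3 (by positivity) (by positivity))
    _ = _ := by rw [h4]; ring

theorem prob_QBME_ge {Ω G : Type} [Fintype Ω] [DecidableEq Ω] [Fintype G] [DecidableEq G]
    {z : Ω × G} {X : Ω → ℝ} {n B δ : ℝ} (hX : ∀ ω, 0 ≤ X ω) (hn : 1 ≤ n) (hB : 0 < B)
    (h0 : 0 < δ) (hδ : δ ≤ 1 / 2) {p : Ω → ℝ} {U : Matrix.unitaryGroup (Ω × G) ℂ} {v u : ℝ}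
    (hp : p ∈ stdSimplex ℝ Ω) (hU : IsOracle U z p) (hv : 0 < v) (hv1 : v ≤ 1)
    (hu : expect p (fun ω => |X ω| ^ (1 + v)) ≤ u) (hk : B ≤ upperEnd n B (lastSegment δ)) :
    1 - δ ≤ (QBME amplitudeMeanEstimator z X n 1 B δ).prob U
      {m | |m - expect p X| ≤ Real.sqrt (u * B ^ (1 - v)) * lgInv δ / n +
        B * Real.sqrt (lgInv δ) / (2 * n ^ 2) + u / B ^ v} := by
  have hL := one_le_lgInv h0 hδ
  have hkL := lastSegment_le h0 hδ
  set L := lgInv δ with hLdef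
  have hL0 : 0 < L := by linarith
  have ht : 0 < 1 * n * Real.sqrt L := by positivity
  simp only [fun ω => abs_of_nonneg (hX ω)] at hu
  set μ : ℕ → ℝ := fun ℓ => expect p (scaledSegment X n B ℓ) with hμ
  set e : ℕ → ℝ := fun ℓ => min (μ ℓ) (1 / 2 * Real.sqrt (μ ℓ) * L / (1 * n * Real.sqrt L)) with he
  have h1 := QueryAlg.pow_le_prob_weightedSum U (fun ℓ => (upperEnd_pos hn hB ℓ).le)
    (fun ℓ => amplitudeMeanEstimator Ω G z (scaledSegment X n B ℓ) (1 * n * Real.sqrt L) δ)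
    (y := μ) (e := e) (q := 1 - δ ^ 2) (by nlinarith) (fun ℓ =>
      prob_amplitudeMeanEstimator_ge (scaledSegment_mem hn hB hX ℓ) ht h0 hδ hp hU)
    (lastSegment δ + 1)
  refine (one_sub_le_pow_lastSegment h0 hδ).trans (h1.trans (QueryAlg.prob_mono U ?_ _))
  intro m hm
  rw [Set.mem_ofPred_eq] at hm ⊢
  have h2 := segment_error_le hp hX hn hB hL hkL hv hv1 hu hk (e := e)
    (fun ℓ => min_le_left _ _) (fun ℓ => (min_le_right _ _).trans_eq (by
      have hs := Real.mul_self_sqrt hL0.le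
      have hs0 : 0 < Real.sqrt L := Real.sqrt_pos.2 hL0
      rw [div_eq_div_iff (by positivity) (by positivity)]
      linear_combination (-Real.sqrt (μ ℓ) * n) * hs))
  -- Ignoring the values above all segments biases the estimate downwards only, so the bias enters
  -- with a known sign.
  have h3 : ∑ ℓ ∈ Finset.range (lastSegment δ + 1), upperEnd n B ℓ * μ ℓ ≤ expect p X := by
    simp only [hμ, upperEnd_mul_expect_scaledSegment hn hB]
    rw [← expect_sum]
    refine expect_mono hp fun ω => ?_
    rw [← Finset.sum_mul, sum_segmentIndicator hn hB (hX ω)]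
    have := hX ω
    split_ifs <;> linarith
  refine le_trans ?_ h2
  have h4 := abs_le.1 hm
  rw [abs_le]
  constructor <;> linarith

/-- The error bound for the value of `B` that balances its terms. -/
theorem balanced_error {u n L v B : ℝ} (hu : 0 < u) (hn : 0 < n) (hL : 0 < L) (hv : 0 < v)
    (hB : B = (Real.sqrt u * n / L) ^ (2 / (1 + v))) :
    Real.sqrt (u * B ^ (1 - v)) * L / n =
        u ^ (1 / (1 + v)) * L ^ (2 * v / (1 + v)) / n ^ (2 * v / (1 + v)) ∧
      B * L ^ 2 / n ^ 2 = u ^ (1 / (1 + v)) * L ^ (2 * v / (1 + v)) / n ^ (2 * v / (1 + v)) ∧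
      u / B ^ v = u ^ (1 / (1 + v)) * L ^ (2 * v / (1 + v)) / n ^ (2 * v / (1 + v)) := by
  -- In terms of `R = n / L` the choice of `B` reads `B ^ (1 + v) = u * R ^ 2`, and all three terms
  -- become `B / R ^ 2`.
  obtain ⟨R, hR, rfl⟩ : ∃ R, 0 < R ∧ n = R * L := ⟨n / L, by positivity, by field_simp⟩
  have hv' : 1 + v ≠ 0 := by positivity
  have hbase : Real.sqrt u * (R * L) / L = Real.sqrt u * R := by field_simp
  rw [hbase] at hB
  have hs : 0 < Real.sqrt u := Real.sqrt_pos.2 hu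
  have hB0 : 0 < B := by rw [hB]; positivity
  have hpow : B ^ (1 + v) = u * R ^ 2 := by
    rw [hB, ← Real.rpow_mul (by positivity), div_mul_cancel₀ _ hv',
      show (2 : ℝ) = ((2 : ℕ) : ℝ) by norm_num, Real.rpow_natCast, mul_pow, Real.sq_sqrt hu.le]
  have hu' : u = B ^ (1 + v) / R ^ 2 := by rw [hpow]; field_simp
  have hZ : u ^ (1 / (1 + v)) * L ^ (2 * v / (1 + v)) / (R * L) ^ (2 * v / (1 + v)) = B / R ^ 2 := by
    have hL' : 0 < L ^ (2 * v / (1 + v)) := by positivity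
    have e2 : R ^ (2 * v / (1 + v)) * (R ^ 2) ^ (1 / (1 + v)) = R ^ 2 := by
      rw [← Real.rpow_natCast R 2, ← Real.rpow_mul hR.le, ← Real.rpow_add hR]
      congr 1
      push_cast
      field_simp
      ring
    rw [Real.mul_rpow hR.le hL.le, hu', Real.div_rpow (by positivity) (by positivity),
      ← Real.rpow_mul hB0.le, mul_one_div_cancel hv', Real.rpow_one]
    have h1 : 0 < R ^ (2 * v / (1 + v)) := by positivity
    have h2 : 0 < (R ^ 2) ^ (1 / (1 + v)) := by positivity
    calc B / (R ^ 2) ^ (1 / (1 + v)) * L ^ (2 * v / (1 + v)) /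
          (R ^ (2 * v / (1 + v)) * L ^ (2 * v / (1 + v))) =
          B / (R ^ (2 * v / (1 + v)) * (R ^ 2) ^ (1 / (1 + v))) := by
          generalize R ^ (2 * v / (1 + v)) = x at h1
          generalize L ^ (2 * v / (1 + v)) = y at hL'
          generalize (R ^ 2) ^ (1 / (1 + v)) = w at h2
          field_simp
      _ = B / R ^ 2 := by rw [e2]
  rw [hZ]
  refine ⟨?_, ?_, ?_⟩
  · have e1 : u * B ^ (1 - v) = (B / R) ^ 2 := by
      rw [hu', div_mul_eq_mul_div, ← Real.rpow_add hB0, div_pow,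
        show 1 + v + (1 - v) = ((2 : ℕ) : ℝ) by push_cast; ring, Real.rpow_natCast]
    rw [e1, Real.sqrt_sq (by positivity)]
    field_simp
  · field_simp
  · rw [hu', Real.rpow_add hB0, Real.rpow_one]
    have : 0 < B ^ v := by positivity
    field_simp

theorem theorem1 :
    ∃ QME : MeanEstimator, IsQuantumMonteCarlo QME ∧
      ∃ c > (0 : ℝ), ∃ K > (0 : ℝ), ∃ C > (0 : ℝ),
        ∀ (Ω G : Type) [Fintype Ω] [DecidableEq Ω] [Fintype G] [DecidableEq G]
          (z : Ω × G) (X : Ω → ℝ) (n B δ : ℝ),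
          (∀ ω, 0 ≤ X ω) → 1 ≤ n → 0 < B → 0 < δ → δ ≤ 1 / 2 →
          ((QBME QME z X n c B δ).queries : ℝ) ≤ K * n * lgInv δ ^ (3 / 2 : ℝ) ∧
          ∀ (p : Ω → ℝ) (U : Matrix.unitaryGroup (Ω × G) ℂ) (v u : ℝ),
            p ∈ stdSimplex ℝ Ω → IsOracle U z p → 0 < v → v ≤ 1 → 0 < u →
            expect p (fun ω => |X ω| ^ (1 + v)) ≤ u →
            B ≤ upperEnd n B (lastSegment δ) →
            1 - δ ≤ (QBME QME z X n c B δ).prob U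
              {m | |m - expect p X| ≤
                Real.sqrt 2 * Real.sqrt (u * B ^ (1 - v)) * lgInv δ / (c * n)
                  + 3 * B * lgInv δ ^ 2 / (c * n ^ 2 * Real.sqrt (lgInv δ)) + u / B ^ v} ∧
            (B = (Real.sqrt u * n / lgInv δ) ^ (2 / (1 + v)) →
              1 - δ ≤ (QBME QME z X n c B δ).prob U
                {m | |m - expect p X| ≤
                  C * (u ^ (1 / (1 + v)) * lgInv δ ^ (2 * v / (1 + v)) / n ^ (2 * v / (1 + v)))}) := by
  -- `8424 = 2 * 4212` since there are at most `2L` segments. The balanced error has three terms,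
  -- each at most the target, so `6` is not tight.
  refine ⟨amplitudeMeanEstimator, isQuantumMonteCarlo_amplitudeMeanEstimator, 1, one_pos, 8424,
    by norm_num, 6, by norm_num, ?_⟩
  intro Ω G _ _ _ _ z X n B δ hX hn hB h0 hδ
  refine ⟨queries_QBME_le z X B hn h0 hδ, ?_⟩
  intro p U v u hp hU hv hv1 hu0 hu hk
  have hL := one_le_lgInv h0 hδ
  have hprob := prob_QBME_ge hX hn hB h0 hδ hp hU hv hv1 hu hk
  have hn0 : 0 < n := by linarith
  have hs1 : 1 ≤ Real.sqrt (lgInv δ) := Real.one_le_sqrt.2 hL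
  have hs := Real.sq_sqrt (zero_le_one.trans hL)
  have hmono : ∀ E : ℝ, Real.sqrt (u * B ^ (1 - v)) * lgInv δ / n +
      B * Real.sqrt (lgInv δ) / (2 * n ^ 2) + u / B ^ v ≤ E →
      1 - δ ≤ (QBME amplitudeMeanEstimator z X n 1 B δ).prob U {m | |m - expect p X| ≤ E} := by
    refine fun E hE => hprob.trans (QueryAlg.prob_mono U (fun m hm => ?_) _)
    rw [Set.mem_ofPred_eq] at hm ⊢
    exact hm.trans hE
  refine ⟨hmono _ ?_, fun hBeq => hmono _ ?_⟩
  · have h2 : 1 ≤ Real.sqrt 2 := Real.one_le_sqrt.2 one_le_two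
    have t1 : Real.sqrt (u * B ^ (1 - v)) * lgInv δ / n ≤
        Real.sqrt 2 * Real.sqrt (u * B ^ (1 - v)) * lgInv δ / (1 * n) := by
      rw [one_mul, mul_assoc, mul_div_assoc (Real.sqrt 2)]
      exact le_mul_of_one_le_left (by positivity) h2
    have t2 : B * Real.sqrt (lgInv δ) / (2 * n ^ 2) ≤
        3 * B * lgInv δ ^ 2 / (1 * n ^ 2 * Real.sqrt (lgInv δ)) := by
      rw [div_le_div_iff₀ (by positivity) (by positivity)]
      have e : Real.sqrt (lgInv δ) * Real.sqrt (lgInv δ) ≤ 6 * lgInv δ ^ 2 := by nlinarith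
      calc _ = B * n ^ 2 * (Real.sqrt (lgInv δ) * Real.sqrt (lgInv δ)) := by ring
        _ ≤ B * n ^ 2 * (6 * lgInv δ ^ 2) := by gcongr
        _ = _ := by ring
    linarith
  · obtain ⟨e1, e2, e3⟩ := balanced_error hu0 hn0 (by linarith) hv hBeq
    rw [e1, e3]
    -- Since `√L ≤ L²`, the second term is also dominated by a balanced one.
    have hsL : Real.sqrt (lgInv δ) ≤ lgInv δ ^ 2 := by nlinarith
    have t2 : B * Real.sqrt (lgInv δ) / (2 * n ^ 2) ≤ B * lgInv δ ^ 2 / n ^ 2 := by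
      calc _ ≤ B * lgInv δ ^ 2 / (2 * n ^ 2) := by gcongr
        _ ≤ _ := by
          gcongr
          linarith [sq_nonneg n]
    rw [e2] at t2
    have : 0 ≤ u ^ (1 / (1 + v)) * lgInv δ ^ (2 * v / (1 + v)) / n ^ (2 * v / (1 + v)) := by
      positivity
    linarith
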